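/- Let $\mathbb F$ be a finite field with $q$ elements. A code pair $(C_1,C_2)$ of length $n$ consists of two subspaces of $\mathbb F^n$ with $C_2^{\perp}\le C_1$ (dual with respect to the dot product); it is an $[[n,k]]$ code pair for $k=\dim C_1+\dim C_2-n$, and its rate is $k/n$. A probability distribution $W$ on $\mathbb F$ defines the memoryless additive channel that adds to each transmitted symbol an independent error with distribution $W$. A syndrome decoder for a quotient code $C/B$ ($B\le C\le\mathbb F^n$) computes from the syndrome $He$ of the error pattern $e$, where $H$ is a full-rank parity check matrix of $C$, an estimate $\hat e$ of $e$; its decoding error probability is the probability that $e-\hat e\notin B$. Polynomial complexity means that the estimates are computed by straight-line programs (circuits of fan-in two) over $\mathbb F$ whose length is bounded by one fixed polynomial in the code length. Let $W_1,W_2$ be probability distributions on $\mathbb F$. (a) Let $E(W_j,r)$ be real numbers, for $j=1,2$ and $r\in\mathbb R$, and let $S$ be a set of rate pairs such that for every $(r_1,r_2)\in S$ there is a sequence of code pairs $(C_1,C_2)$ of lengths $n\to\infty$ for which the rate $\dim C_j/n$ tends to $r_j$ and the decoding error probabilities $P_1$ of $C_1/C_2^{\perp}$ over $W_1$ and $P_2$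 of $C_2/C_1^{\perp}$ over $W_2$, for suitable syndrome decoders, satisfy $$P_j\le q^{-nE(W_j,r_j)+o(n)},\qquad j=1,2.$$ Then for every $R_{\rm o}$ with $0<R_{\rm o}\le 1$ there is a sequence of $[[N_{\rm o},K_{\rm o}]]$ code pairs $(L_1,L_2)$ over $\mathbb F$ with $N_{\rm o}\to\infty$, together with syndrome decoders for $L_1/L_2^{\perp}$ and $L_2/L_1^{\perp}$, such that: (i) $K_{\rm o}/N_{\rm o}\to R_{\rm o}$; (ii) the decoding error probabilities $P_{{\rm e},1}$ of $L_1/L_2^{\perp}$ over $W_1$ and $P_{{\rm e},2}$ of $L_2/L_1^{\perp}$ over $W_2$ satisfy, for $j=1,2$, $$\limsup_{N_{\rm o}\to\infty}-\frac1{N_{\rm o}}\log_q P_{{\rm e},j}\ \ge\ \frac12\,\sup\,\min_{i\in\{1,2\}}(1-R_i)E(W_i,r_i),$$ where the supremum is over all $(r_1,r_2,R_1,R_2)\in[0,1]^4$ with $(r_1,r_2)\in S$ and $(r_1+r_2-1)(R_1+R_2-1)=R_{\rm o}$ (with $-\log_q 0=+\infty$ and $\sup\emptyset=-\infty$); (iii)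 these decoders, for $L_1/L_2^{\perp}$ and for $L_2/L_1^{\perp}$, have polynomial complexity. (b) If $1-H(W_1)-H(W_2)\ge 0$, where $H$ is the Shannon entropy to base $q$, then the rate $1-H(W_1)-H(W_2)$ is achievable for $(W_1,W_2)$ by efficiently decodable code pairs: there is a sequence of code pairs $(L_1,L_2)$ over $\mathbb F$ with lengths tending to infinity and rates tending to $1-H(W_1)-H(W_2)$, together with syndrome decoders of polynomial complexity for $L_1/L_2^{\perp}$ and $L_2/L_1^{\perp}$, whose decoding error probabilities over $W_1$ and $W_2$, respectively, both tend to $0$. -/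

import Mathlib

open Filter Topology Asymptotics
open scoped ENNReal

noncomputable section

namespace CSS

/-- The dual code `{y | ∀ x ∈ C, x · y = 0}` with respect to the dot product. -/
def dual {F : Type*} [Field F] {n : ℕ} (C : Submodule F (Fin n → F)) :
    Submodule F (Fin n → F) where
  carrier := {y | ∀ x ∈ C, x ⬝ᵥ y = 0}
  add_mem' := by
    intro a b ha hb x hx
    rw [dotProduct_add, ha x hx, hb x hx, add_zero]
  zero_mem' := by
    intro x _
    exact dotProduct_zero x
  smul_mem' := by
    intro c y hy x hx
    rw [dotProduct_smul, hy x hx, smul_zero]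

/-- A code pair `(C₁, C₂)` of length `n`: two linear codes with `C₂^⊥ ≤ C₁`.
Here `C₁ = code 0` and `C₂ = code 1`. -/
structure CodePair (F : Type*) [Field F] (n : ℕ) where
  code : Fin 2 → Submodule F (Fin n → F)
  css : dual (code 1) ≤ code 0

/-- The rate `k / n` of an `[[n, k]]` code pair, `k = dim C₁ + dim C₂ - n`. -/
def CodePair.rate {F : Type*} [Field F] {n : ℕ} (C : CodePair F n) : ℝ :=
  ((Module.finrank F (C.code 0) : ℝ) + (Module.finrank F (C.code 1) : ℝ) - (n : ℝ)) / (n : ℝ)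

/-- The rate `k_j / n` of the classical code `C_j`. -/
def CodePair.classicalRate {F : Type*} [Field F] {n : ℕ} (C : CodePair F n) (j : Fin 2) : ℝ :=
  (Module.finrank F (C.code j) : ℝ) / (n : ℝ)

/-- A syndrome decoder for the linear code `C`: a parity check matrix `H` of `C` (full row rank,
kernel `C`) and a map which estimates the error pattern `e` from its syndrome `H e`. -/
structure SyndromeDecoder {F : Type*} [Field F] {n : ℕ} (C : Submodule F (Fin n → F)) where
  checks : ℕ
  H : Matrix (Fin checks) (Fin n) F
  linearIndependent_rows : LinearIndependent F H.row
  mem_code_iff : ∀ x : Fin n → F, x ∈ C ↔ H.mulVec x = 0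
  estimate : (Fin checks → F) → (Fin n → F)

open Classical in
/-- The decoding error probability of the quotient code `C / B` over the memoryless additive
channel `W`: the error pattern `e` has probability `∏ W (e i)`, and decoding is in error if and
only if `e` minus its estimate is not in `B`. -/
def SyndromeDecoder.errorProb {F : Type*} [Field F] [Fintype F] {n : ℕ}
    {C : Submodule F (Fin n → F)} (D : SyndromeDecoder C) (B : Submodule F (Fin n → F))
    (W : PMF F) : ℝ≥0∞ :=
  ∑ e : Fin n → F, if e - D.estimate (D.H.mulVec e) ∈ B then 0 else ∏ i, W (e i)

/-- An instruction `x_dst := op x_left x_right` on registers with values in `F`.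
For a fixed finite field it amounts to a bounded number of bit operations. -/
structure Instr (F : Type*) where
  dst : ℕ
  op : F → F → F
  left : ℕ
  right : ℕ

/-- The effect of one instruction on the registers. -/
def Instr.step {F : Type*} (I : Instr F) (x : ℕ → F) : ℕ → F :=
  Function.update x I.dst (I.op (x I.left) (x I.right))

/-- The registers at the start: the input, followed by zeros. -/
def loadInput {F : Type*} [Zero F] {m : ℕ} (s : Fin m → F) : ℕ → F :=
  fun t => if h : t < m then s ⟨t, h⟩ else 0

/-- The map `F^m → F^n` computed by a straight-line program (equivalently, by a circuit of
fan-in two): the instructions are executed one after the other, and the output is then read off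
the registers `0, …, n - 1`. -/
def runProgram {F : Type*} [Zero F] (P : List (Instr F)) {m : ℕ} (n : ℕ) (s : Fin m → F) :
    Fin n → F :=
  fun i => P.foldl (fun x I => I.step x) (loadInput s) i

/-- The estimate of the error pattern is computed from the syndrome in at most `t` steps. -/
def SyndromeDecoder.RunsIn {F : Type*} [Field F] {n : ℕ} {C : Submodule F (Fin n → F)}
    (D : SyndromeDecoder C) (t : ℕ) : Prop :=
  ∃ P : List (Instr F), P.length ≤ t ∧ ∀ s, runProgram P n s = D.estimate s

/-- A pair of syndrome decoders, for `C₁ / C₂^⊥` and for `C₂ / C₁^⊥`. -/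
abbrev CodePair.Decoders {F : Type*} [Field F] {n : ℕ} (C : CodePair F n) :=
  ∀ j : Fin 2, SyndromeDecoder (C.code j)

/-- The decoding error probability of `C₁ / C₂^⊥` over `W₁` (for `j = 0`) and of `C₂ / C₁^⊥` over
`W₂` (for `j = 1`); `j.rev` is the other index. -/
def CodePair.Decoders.errorProb {F : Type*} [Field F] [Fintype F] {n : ℕ} {C : CodePair F n}
    (D : C.Decoders) (W : Fin 2 → PMF F) (j : Fin 2) : ℝ≥0∞ :=
  (D j).errorProb (dual (C.code j.rev)) (W j)

/-- There are code pairs `(C₁, C₂)` of lengths `n → ∞` with the rate of `C_j` tending to `r_j` and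
with decoding error probabilities `P_j ≤ q ^ (- n E(W_j, r_j) + o(n))`, for `j = 1, 2`. -/
def ExponentAttained {F : Type*} [Field F] [Fintype F] (W : Fin 2 → PMF F)
    (E : PMF F → ℝ → ℝ) (r : Fin 2 → ℝ) : Prop :=
  ∃ (n : ℕ → ℕ) (C : ∀ ν, CodePair F (n ν)) (D : ∀ ν, (C ν).Decoders) (δ : Fin 2 → ℕ → ℝ),
    Tendsto n atTop atTop ∧
    ∀ j, Tendsto (fun ν => (C ν).classicalRate j) atTop (𝓝 (r j)) ∧
      (δ j =o[atTop] fun ν => (n ν : ℝ)) ∧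
      ∀ ν, (D ν).errorProb W j ≤
        ENNReal.ofReal ((Fintype.card F : ℝ) ^ (-(n ν : ℝ) * E (W j) (r j) + δ j ν))

/-- `-(1 / N) log_q P`, in the extended reals (so that it is `⊤` for `P = 0`). -/
def exponentOf (q N : ℕ) (P : ℝ≥0∞) : EReal :=
  -(ENNReal.log P) / (((N : ℝ) * Real.log q : ℝ) : EReal)

/-- The quadruples `(r₁, r₂, R₁, R₂)` in `[0, 1]^4` with `(r₁, r₂) ∈ S` and
`(r₁ + r₂ - 1) (R₁ + R₂ - 1) = Ro`. -/
def rateSplittings (S : Set (Fin 2 → ℝ)) (Ro : ℝ) : Set ((Fin 2 → ℝ) × (Fin 2 → ℝ)) :=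
  {p | p.1 ∈ S ∧ (∀ j, 0 ≤ p.1 j ∧ p.1 j ≤ 1) ∧ (∀ j, 0 ≤ p.2 j ∧ p.2 j ≤ 1) ∧
    (p.1 0 + p.1 1 - 1) * (p.2 0 + p.2 1 - 1) = Ro}

/-- `min_j (1 - R_j) E(W_j, r_j)`. -/
def splitExponent {F : Type*} (W : Fin 2 → PMF F) (E : PMF F → ℝ → ℝ)
    (p : (Fin 2 → ℝ) × (Fin 2 → ℝ)) : ℝ :=
  min ((1 - p.2 0) * E (W 0) (p.1 0)) ((1 - p.2 1) * E (W 1) (p.1 1))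

/-- The Shannon entropy to base `q`, the size of the alphabet. -/
def entropy {F : Type*} [Fintype F] (W : PMF F) : ℝ :=
  ∑ a, Real.negMulLog (W a).toReal / Real.log (Fintype.card F)

/-- All decoders of the sequence run in time bounded by one polynomial in the code length. -/
def PolyTime {F : Type*} [Field F] {N : ℕ → ℕ} {L : ∀ ν, CodePair F (N ν)}
    (D : ∀ ν, (L ν).Decoders) : Prop :=
  ∃ p : Polynomial ℕ, ∀ ν j, (D ν j).RunsIn (p.eval (N ν))

end CSS

end

/-! Both parts rest on one construction: the concatenation of a code pair with Reed–Solomon codes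
over the field `K` with `q ^ k` elements, `k = dim C₁ + dim C₂ - n`. The quotients `C₁ / C₂^⊥` and
`C₂ / C₁^⊥` have dimension `k` and are dual to each other under the dot product. They can therefore
be identified with `K` in such a way that the dot product becomes `l (z * w)` for a fixed nonzero
functional `l` (`exists_frame`). Orthogonality over `K` then implies orthogonality over `F`, and
Reed–Solomon codes of length `q ^ k` with `d₁ + d₂ ≤ q ^ k` checks give a code pair of length `N = q
^ k * n` (`dual_concatCode_le`).

The inner decoder is applied to each block, and the outer decoder repairs up to `d / 2` wrong
blocks. Failure needs more wrong blocks than that, so an inner error probability `P` becomes at most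
`2 ^ (q ^ k) * P ^ (d / 2 + 1)` (`exists_concatenation`). With `d_j ≈ (1 - R_j) q ^ k` the exponent
per symbol is about `(1 - R_j) E / 2`. The factor `1 / 2` is the price of decoding up to half the
number of checks, and `2 ^ (q ^ k)` costs only `O(1 / n)`. The rate is `(k / n) (1 - (d₁ + d₂) / q ^
k)`, close to `(r₁ + r₂ - 1) (R₁ + R₂ - 1)`.

Inner decoding is table lookup in size `q ^ n`. A positive total rate forces `n ≤ c k` with `c`
depending only on that rate, so `q ^ n ≤ N ^ c`. Outer decoding is linear algebra over `K`, whose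
operations are themselves tables over `F`. To reach the supremum, the `ν`-th code is built from the
`ν`-th term of a maximizing sequence of splittings; this is legitimate because `c` is the same for
all of them.

For (b), averaging over a balanced family (`exists_balanced_family`) and a Chernoff bound
(`exists_typical_sets`) give code pairs with classical rates just below `1 - H(W_j)` and
exponentially small error. Concatenation with outer rates `1 - η`, with `η → 0`, makes them
efficiently decodable. -/

namespace CSS

/-! ### Cost calculus for straight-line computations -/

/-- `Reach t A B`: starting with the functions in `A`, the functions in `B` are obtained by `t`
successive applications of binary operations to functions already available. -/
inductive Reach {X α : Type*} : ℕ → Set (X → α) → Set (X → α) → Prop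
  | refl (A : Set (X → α)) : Reach 0 A A
  | step {t : ℕ} {A B : Set (X → α)} {f g : X → α} (op : α → α → α) :
      Reach t A B → f ∈ B → g ∈ B → Reach (t + 1) A (insert (fun x => op (f x) (g x)) B)

/-- The functions in `B` can be computed from those in `A` in at most `t` steps. -/
def Cost {X α : Type*} (A : Set (X → α)) (t : ℕ) (B : Set (X → α)) : Prop :=
  ∃ s ≤ t, ∃ Z, Reach s A Z ∧ B ⊆ Z

section Calculus

variable {X α : Type*} {A B C Z : Set (X → α)} {s t : ℕ}

theorem Reach.subset (h : Reach t A B) : A ⊆ B := by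
  induction h with
  | refl => exact subset_rfl
  | step op _ _ _ ih => exact ih.trans (Set.subset_insert _ _)

theorem Reach.union (h : Reach t A B) (Z : Set (X → α)) : Reach t (A ∪ Z) (B ∪ Z) := by
  induction h with
  | refl => exact .refl _
  | step op _ hf hg ih =>
    rw [Set.insert_union]
    exact .step op ih (.inl hf) (.inl hg)

theorem Reach.trans (h : Reach t A B) (h' : Reach s B C) : Reach (t + s) A C := by
  induction h' with
  | refl => exact h
  | step op _ hf hg ih => exact .step op (ih h) hf hg

theorem Cost.of_subset (h : B ⊆ A) : Cost A t B := ⟨0, t.zero_le, A, .refl A, h⟩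

theorem Cost.mono {A' B' : Set (X → α)} {t' : ℕ} (h : Cost A t B) (hA : A ⊆ A') (ht : t ≤ t')
    (hB : B' ⊆ B) : Cost A' t' B' := by
  obtain ⟨s, hs, Z, hZ, hBZ⟩ := h
  refine ⟨s, hs.trans ht, Z ∪ A', ?_, hB.trans (hBZ.trans Set.subset_union_left)⟩
  simpa [Set.union_eq_self_of_subset_left hA] using hZ.union A'

theorem Cost.le {t' : ℕ} (h : Cost A t B) (ht : t ≤ t') : Cost A t' B :=
  h.mono subset_rfl ht subset_rfl

theorem Cost.weaken {A' : Set (X → α)} (h : Cost A t B) (hA : A ⊆ A') : Cost A' t B :=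
  h.mono hA le_rfl subset_rfl

theorem Cost.union_self (h : Cost A t B) : Cost A t (A ∪ B) := by
  obtain ⟨s, hs, Z, hZ, hBZ⟩ := h
  exact ⟨s, hs, Z, hZ, Set.union_subset hZ.subset hBZ⟩

theorem Cost.trans (h : Cost A t B) (h' : Cost (A ∪ B) s C) : Cost A (t + s) C := by
  obtain ⟨t', ht, Z, hZ, hBZ⟩ := h.union_self
  obtain ⟨s', hs, Y, hY, hCY⟩ := h'.weaken hBZ
  exact ⟨t' + s', by omega, Y, hZ.trans hY, hCY⟩

theorem Cost.union (h : Cost A t B) (h' : Cost A s C) : Cost A (t + s) (B ∪ C) := by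
  refine h.trans ((h'.weaken Set.subset_union_left).union_self.mono subset_rfl le_rfl ?_)
  exact Set.union_subset (fun _ hx => .inl (.inr hx)) (fun _ hx => .inr hx)

theorem Cost.biUnion {ι : Type*} (I : Finset ι) (D : ι → Set (X → α))
    (h : ∀ i ∈ I, Cost A t (D i)) : Cost A (I.card * t) (⋃ i ∈ I, D i) := by
  classical
  induction I using Finset.induction_on with
  | empty => exact .of_subset (by simp)
  | insert a I ha ih =>
    rw [Finset.card_insert_of_notMem ha, Finset.set_biUnion_insert, add_mul, one_mul, add_comm]
    exact (h a (by simp)).union (ih fun i hi => h i (by simp [hi]))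

theorem Cost.range {ι : Type*} [Fintype ι] (f : ι → X → α) (h : ∀ i, Cost A t {f i}) :
    Cost A (Fintype.card ι * t) (Set.range f) := by
  refine (Cost.biUnion Finset.univ (fun i => {f i}) fun i _ => h i).mono subset_rfl le_rfl ?_
  rintro _ ⟨i, rfl⟩
  simp

theorem Cost.op {f g : X → α} (op : α → α → α) (hf : Cost A t {f}) (hg : Cost A s {g}) :
    Cost A (t + s + 1) {fun x => op (f x) (g x)} := by
  obtain ⟨u, hu, Z, hZ, hfg⟩ := hf.union hg
  refine ⟨u + 1, by omega, _, .step op hZ (hfg (.inl rfl)) (hfg (.inr rfl)), ?_⟩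
  simp

theorem Cost.mem {f : X → α} (hf : f ∈ A) : Cost A 0 {f} := .of_subset (by simpa)

/-- An instruction may ignore its operands, so a constant takes one step as soon as some function is
available to serve as operand. -/
theorem Cost.const (hA : A.Nonempty) (c : α) : Cost A 1 {fun _ => c} := by
  obtain ⟨f, hf⟩ := hA
  exact Cost.op (fun _ _ => c) (.mem hf) (.mem hf)

theorem Cost.sum {ι : Type*} {M : Type*} [AddCommMonoid M] {A : Set (X → M)} (hA : A.Nonempty)
    (I : Finset ι) (u : ι → X → M) (h : ∀ i ∈ I, Cost A t {u i}) :
    Cost A (I.card * (t + 1) + 1) {fun x => ∑ i ∈ I, u i x} := by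
  classical
  induction I using Finset.induction_on with
  | empty => simpa using Cost.const hA (0 : M)
  | insert a I ha ih =>
    simp only [Finset.sum_insert ha, Finset.card_insert_of_notMem ha]
    exact (Cost.op (· + ·) (h a (by simp)) (ih fun i hi => h i (by simp [hi]))).le
      (le_of_eq (by ring))

/-- Every function on `F^m` is computed by table lookup. -/
theorem Cost.lookup_fin {F : Type*} [Field F] [Fintype F] {A : Set (X → F)} (hA : A.Nonempty)
    {m : ℕ} (f : (Fin m → F) → F) (u : Fin m → X → F) (hu : ∀ i, u i ∈ A) :
    Cost A (6 * Fintype.card F ^ m) {fun x => f fun i => u i x} := by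
  classical
  have hq : 2 ≤ Fintype.card F := Fintype.one_lt_card
  -- The recursion is `c (m + 1) = q (c m + 2) + 1`. The subtracted `5` makes the induction close,
  -- precisely because `q ≥ 2`.
  suffices h : Cost A (6 * Fintype.card F ^ m - 5) {fun x => f fun i => u i x} from
    h.le (Nat.sub_le _ _)
  induction m with
  | zero =>
    have : (fun x => f fun i => u i x) = fun _ => f Fin.elim0 := by
      funext x
      congr 1
      exact Subsingleton.elim _ _
    rw [this]
    exact Cost.const hA _
  | succ m ih =>
    -- Branching on the first argument becomes straight-line code: all branches are computed, and
    -- the sum has a single surviving term.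
    have key : (fun x => f fun i => u i x) = fun x => ∑ c : F,
        if u 0 x = c then f (Fin.cons c fun i => u i.succ x) else 0 := by
      funext x
      rw [Finset.sum_ite_eq, if_pos (Finset.mem_univ _)]
      congr 1
      funext i
      refine Fin.cases ?_ (fun i => ?_) i <;> simp
    rw [key]
    refine (Cost.sum hA Finset.univ
      (fun (c : F) x => if u 0 x = c then f (Fin.cons c fun i => u i.succ x) else 0)
      (t := 6 * Fintype.card F ^ m - 5 + 1) fun c _ => ?_).le ?_
    · refine (Cost.op (fun a b => if a = c then b else 0) (.mem (hu 0))
        (ih (fun v => f (Fin.cons c v)) (fun i => u i.succ) fun i => hu _)).le (by omega)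
    · rw [Finset.card_univ, pow_succ]
      have : 1 ≤ Fintype.card F ^ m := Nat.one_le_pow _ _ (by omega)
      obtain ⟨a, ha⟩ := Nat.exists_eq_add_of_le this
      rw [ha]
      have : 6 * (1 + a) - 5 + 1 + 1 = 6 * a + 3 := by omega
      rw [this]
      have : 6 * ((1 + a) * Fintype.card F) = Fintype.card F * (6 * a + 3) +
          3 * Fintype.card F := by ring
      rw [this]
      omega

theorem Cost.lookup {F ι : Type*} [Field F] [Fintype F] [Fintype ι] {A : Set (X → F)}
    (hA : A.Nonempty) (f : (ι → F) → F) (u : ι → X → F) (hu : ∀ i, u i ∈ A) :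
    Cost A (6 * Fintype.card F ^ Fintype.card ι) {fun x => f fun i => u i x} := by
  have := Cost.lookup_fin hA (fun v => f fun i => v (Fintype.equivFin ι i))
    (fun i => u ((Fintype.equivFin ι).symm i)) fun i => hu _
  simpa using this

/-- The coordinates with respect to `κ` of the functions in `A`. -/
def expand {K ι F : Type*} (κ : K → ι → F) (A : Set (X → K)) : Set (X → F) :=
  {h | ∃ f ∈ A, ∃ i, h = fun x => κ (f x) i}

theorem expand_mono {K ι F : Type*} (κ : K → ι → F) {A B : Set (X → K)} (h : A ⊆ B) :
    expand κ A ⊆ expand κ B := by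
  rintro _ ⟨f, hf, i, rfl⟩
  exact ⟨f, h hf, i, rfl⟩

/-- A computation over `K` is simulated by one over `F` when the elements of `K` are represented
by vectors over `F`. -/
theorem Cost.expand {K F ι : Type*} [Field F] [Fintype F] [Fintype ι] [Nonempty ι]
    (κ : K ≃ (ι → F)) {A B : Set (X → K)} (h : Cost A t B) :
    Cost (expand κ A) (t * (Fintype.card ι * (6 * Fintype.card F ^ (2 * Fintype.card ι))))
      (expand κ B) := by
  obtain ⟨s, hs, Z, hZ, hBZ⟩ := h
  suffices h : Cost (CSS.expand κ A)
      (s * (Fintype.card ι * (6 * Fintype.card F ^ (2 * Fintype.card ι)))) (CSS.expand κ Z) from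
    h.mono subset_rfl (Nat.mul_le_mul_right _ hs) (expand_mono κ hBZ)
  clear hs hBZ
  induction hZ with
  | refl => exact .of_subset subset_rfl
  | @step s A B f g op _ hf hg ih =>
    rw [add_mul, one_mul]
    have hd : ∀ i : ι, Cost (CSS.expand κ B) (6 * Fintype.card F ^ (2 * Fintype.card ι))
        {fun x => κ (op (f x) (g x)) i} := by
      intro i
      have := Cost.lookup (A := CSS.expand κ B) (ι := ι ⊕ ι)
        ⟨_, f, hf, i, rfl⟩
        (fun v => κ (op (κ.symm fun i => v (.inl i)) (κ.symm fun i => v (.inr i))) i)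
        (Sum.elim (fun i x => κ (f x) i) (fun i x => κ (g x) i))
        (by rintro (i | i); exacts [⟨f, hf, i, rfl⟩, ⟨g, hg, i, rfl⟩])
      simpa [two_mul] using this
    refine ih.trans (((Cost.range _ hd).weaken Set.subset_union_right).union_self.mono
      subset_rfl le_rfl ?_)
    rintro _ ⟨h, rfl | hh, i, rfl⟩
    · exact .inr ⟨i, rfl⟩
    · exact .inl (.inr ⟨h, hh, i, rfl⟩)

end Calculus

/-! ### From cost bounds to register programs -/

section Programs

/-- Since no destination is a source, the successive copies act as one simultaneous copy. -/
theorem run_copy {F α : Type*} (l : List α) (dst src : α → ℕ)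
    (hl : l.Pairwise fun a b => dst a ≠ dst b)
    (hd : ∀ a ∈ l, ∀ b ∈ l, src a ≠ dst b) (x : ℕ → F) :
    let y := (l.map fun a => (⟨dst a, fun u _ => u, src a, src a⟩ : Instr F)).foldl
      (fun x I => I.step x) x
    (∀ a ∈ l, y (dst a) = x (src a)) ∧ ∀ r, (∀ a ∈ l, r ≠ dst a) → y r = x r := by
  induction l generalizing x with
  | nil => simp
  | cons a l ih =>
    rw [List.pairwise_cons] at hl
    have := ih hl.2 (fun a ha b hb => hd a (by simp [ha]) b (by simp [hb]))
      (Function.update x (dst a) (x (src a)))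
    simp only [List.map_cons, List.foldl_cons, Instr.step] at this ⊢
    refine ⟨fun b hb => ?_, fun r hr => ?_⟩
    · rcases List.mem_cons.1 hb with rfl | hb
      · rw [this.2 _ hl.1, Function.update_self]
      · rw [this.1 b hb, Function.update_of_ne (hd b (by simp [hb]) a (by simp))]
    · rw [this.2 r fun b hb => hr b (by simp [hb]), Function.update_of_ne (hr a (by simp))]

variable {F : Type*} [Zero F]

/-- The functions computed from the input coordinates and the constant `0` in `t` steps are found
in registers beyond the first `n` after a program of length `m + t`. -/
theorem Reach.exists_program {m n t : ℕ} {B : Set ((Fin m → F) → F)}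
    (h : Reach t (insert (fun _ => 0) (Set.range fun i s => s i)) B) :
    ∃ P : List (Instr F), P.length = m + t ∧ ∀ f ∈ B, ∃ r, n ≤ r ∧ r < m + n + 1 + m + t ∧
      ∀ s : Fin m → F, P.foldl (fun x I => I.step x) (loadInput s) r = f s := by
  generalize hA : (insert (fun _ => 0) (Set.range fun i s => s i) : Set ((Fin m → F) → F)) = A at h
  induction h with
  | refl =>
    subst hA
    refine ⟨(List.finRange m).map fun i : Fin m =>
      ⟨m + n + 1 + (i : ℕ), fun u _ => u, (i : ℕ), (i : ℕ)⟩, by simp, ?_⟩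
    have key := fun s : Fin m → F => run_copy (List.finRange m) (fun i => m + n + 1 + (i : ℕ))
      (fun i => (i : ℕ))
      ((List.nodup_finRange m).imp fun {a b} hab h => hab (by ext; omega))
      (fun a _ b _ => by omega) (loadInput s)
    rintro f (rfl | ⟨i, rfl⟩)
    -- Register `m + n` lies beyond the input and is never written, so it still holds its initial
    -- `0`.
    · refine ⟨m + n, by omega, by omega, fun s => ?_⟩
      rw [(key s).2 (m + n) fun a _ => by omega]
      simp [loadInput]
    · refine ⟨m + n + 1 + i, by omega, by omega, fun s => ?_⟩
      rw [(key s).1 i (by simp)]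
      simp [loadInput]
  | @step t A B f g op _ hf hg ih =>
    obtain ⟨P, hP, hB⟩ := ih hA
    obtain ⟨rf, _, hrf', hrf⟩ := hB f hf
    obtain ⟨rg, _, hrg', hrg⟩ := hB g hg
    refine ⟨P ++ [⟨m + n + 1 + m + t, op, rf, rg⟩], by simp [hP]; omega, ?_⟩
    rintro h (rfl | hh)
    · refine ⟨m + n + 1 + m + t, by omega, by omega, fun s => ?_⟩
      rw [List.foldl_append, List.foldl_cons, List.foldl_nil, Instr.step, Function.update_self,
        hrf, hrg]
    · obtain ⟨r, h1, h2, h3⟩ := hB h hh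
      refine ⟨r, h1, by omega, fun s => ?_⟩
      have : r ≠ m + n + 1 + m + t := by omega
      rw [List.foldl_append, List.foldl_cons, List.foldl_nil, Instr.step,
        Function.update_of_ne this, h3]

/-- All computed values sit in registers `r i ≥ n`, so the final copy into the output registers `0,
…, n - 1` destroys none of its sources. -/
theorem Cost.exists_program {m n t : ℕ} (g : (Fin m → F) → Fin n → F)
    (h : Cost (insert (fun _ => 0) (Set.range fun i s => s i)) t (Set.range fun i s => g s i)) :
    ∃ P : List (Instr F), P.length ≤ m + t + n ∧ ∀ s, runProgram P n s = g s := by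
  obtain ⟨u, hu, Z, hZ, hgZ⟩ := h
  obtain ⟨P, hP, hB⟩ := hZ.exists_program (n := n)
  choose r hr _ hrun using fun i : Fin n => hB _ (hgZ ⟨i, rfl⟩)
  refine ⟨P ++ (List.finRange n).map fun i : Fin n => ⟨(i : ℕ), fun u _ => u, r i, r i⟩,
    by simp [hP]; omega, fun s => ?_⟩
  funext i
  rw [runProgram, List.foldl_append]
  have key := (run_copy (List.finRange n) (fun i => (i : ℕ)) r
    ((List.nodup_finRange n).imp fun {a b} hab h => hab (by ext; exact h))
    (fun a _ b _ => by have := hr a; omega) (P.foldl (fun x I => I.step x) (loadInput s))).1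
  rw [key i (by simp), hrun]

end Programs

/-! ### Oblivious Gaussian elimination -/

section Elimination

variable {K ι : Type*} [Field K]

open Classical in
/-- The first nonzero entry of `c` along a list, or `0`. -/
noncomputable def pivot (c : ι → K) : List ι → K
  | [] => 0
  | j :: l => if c j = 0 then pivot c l else c j

open Classical in
/-- The vector of the family `V` at the first nonzero entry of `c` along a list, or `0`. -/
noncomputable def pivotVec (c : ι → K) (V : ι → ι → K) : List ι → ι → K
  | [] => fun _ => 0
  | j :: l => fun i => if c j = 0 then pivotVec c V l i else V j i

theorem pivot_cases (c : ι → K) (V : ι → ι → K) (l : List ι) :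
    ((∀ j ∈ l, c j = 0) ∧ pivot c l = 0) ∨
      ∃ j ∈ l, c j ≠ 0 ∧ pivot c l = c j ∧ pivotVec c V l = V j := by
  induction l with
  | nil => simp [pivot]
  | cons j l ih =>
    by_cases hj : c j = 0
    · simp only [pivot, pivotVec, hj, if_true, List.mem_cons, forall_eq_or_imp, true_and]
      refine ih.imp id ?_
      rintro ⟨i, hi, h⟩
      exact ⟨i, .inr hi, h⟩
    · exact .inr ⟨j, by simp, hj, by simp [pivot, hj], by funext i; simp [pivotVec, hj]⟩

variable [Fintype ι]

/-- One step of elimination: the new vectors lie in the hyperplane `a · x = 0`. -/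
noncomputable def eliminate (a : ι → K) (V : ι → ι → K) : ι → ι → K := fun j i =>
  V j i - (∑ l, a l * V j l) / pivot (fun j => ∑ l, a l * V j l) Finset.univ.toList *
    pivotVec (fun j => ∑ l, a l * V j l) V Finset.univ.toList i

/-- Subtracting the multiple `c j / p` of the pivot vector puts every vector in the hyperplane. A
combination already in the hyperplane has `∑ d j * c j = 0`, so the same coefficients represent it
in the new family. The pivot vector is replaced by `0` and not removed, which keeps the shape of the
computation independent of the data. -/
theorem mem_span_eliminate (a : ι → K) (V : ι → ι → K) (x : ι → K) :
    x ∈ Submodule.span K (Set.range (eliminate a V)) ↔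
      x ∈ Submodule.span K (Set.range V) ∧ ∑ i, a i * x i = 0 := by
  classical
  set c : ι → K := fun j => ∑ l, a l * V j l with hc
  set w := pivotVec c V Finset.univ.toList with hw
  set p := pivot c Finset.univ.toList with hp
  have hel : ∀ j, eliminate a V j = V j - (c j / p) • w := fun j => by
    funext i; simp [eliminate, hc, hp, hw]
  let φ : (ι → K) →ₗ[K] K := ∑ i, a i • LinearMap.proj i
  have hφ : ∀ x, φ x = ∑ i, a i * x i := fun x => by simp [φ]
  have hφV : ∀ j, φ (V j) = c j := fun j => hφ _
  rw [← hφ]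
  rcases pivot_cases c V Finset.univ.toList with ⟨h0, h1⟩ | ⟨j, -, hj, h1, h2⟩
  · have hVV : eliminate a V = V := by
      funext j
      rw [hel, h0 j (by simp), zero_div, zero_smul, sub_zero]
    rw [hVV, iff_self_and]
    intro hx
    rw [Submodule.mem_span_range_iff_exists_fun] at hx
    obtain ⟨d, rfl⟩ := hx
    simp [hφV, h0]
  · rw [← hp] at h1
    rw [← hw] at h2
    rw [← h1] at hj
    have hφw : φ w = p := by rw [h2, hφV, h1]
    constructor
    · intro hx
      constructor
      · refine Submodule.span_le.2 ?_ hx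
        rintro _ ⟨i, rfl⟩
        rw [hel, h2]
        exact sub_mem (Submodule.subset_span ⟨i, rfl⟩)
          (Submodule.smul_mem _ _ (Submodule.subset_span ⟨j, rfl⟩))
      · rw [Submodule.mem_span_range_iff_exists_fun] at hx
        obtain ⟨d, rfl⟩ := hx
        simp [hel, hφV, hφw, hj]
    · rintro ⟨hx, h0⟩
      rw [Submodule.mem_span_range_iff_exists_fun] at hx ⊢
      obtain ⟨d, rfl⟩ := hx
      refine ⟨d, ?_⟩
      simp only [map_sum, map_smul, hφV, smul_eq_mul] at h0
      simp only [hel, smul_sub, Finset.sum_sub_distrib, smul_smul, ← Finset.sum_smul]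
      rw [sub_eq_self, ← Finset.sum_congr rfl fun i _ => mul_div_assoc (d i) (c i) p,
        ← Finset.sum_div, h0, zero_div, zero_smul]

/-- A family of vectors which spans the space of solutions of a system of linear equations. -/
noncomputable def solutions [DecidableEq ι] (eqs : List (ι → K)) : ι → ι → K :=
  eqs.foldl (fun V a => eliminate a V) fun j => Pi.single j 1

theorem mem_span_foldl_eliminate (eqs : List (ι → K)) (V : ι → ι → K) (x : ι → K) :
    x ∈ Submodule.span K (Set.range (eqs.foldl (fun V a => eliminate a V) V)) ↔
      x ∈ Submodule.span K (Set.range V) ∧ ∀ a ∈ eqs, ∑ i, a i * x i = 0 := by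
  induction eqs generalizing V with
  | nil => simp
  | cons a eqs ih => rw [List.foldl_cons, ih, mem_span_eliminate, List.forall_mem_cons, and_assoc]

theorem mem_span_solutions [DecidableEq ι] (eqs : List (ι → K)) (x : ι → K) :
    x ∈ Submodule.span K (Set.range (solutions eqs)) ↔ ∀ a ∈ eqs, ∑ i, a i * x i = 0 := by
  rw [solutions, mem_span_foldl_eliminate, and_iff_right]
  rw [Submodule.mem_span_range_iff_exists_fun]
  refine ⟨x, ?_⟩
  funext i
  simp [Finset.sum_apply, Pi.single_apply]

/-- The vector in the family `V` with coordinate `1` at `o`, after scaling. -/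
noncomputable def normalized (V : ι → ι → K) (o : ι) : ι → K := fun i =>
  pivotVec (fun j => V j o) V Finset.univ.toList i / pivot (fun j => V j o) Finset.univ.toList

/-- All members of `V` are multiples of `z`, and some member has a nonzero entry at `o` because `z`
is in the span. Division by that entry recovers `z`; this reads off the solution of a system whose
solution space is a line. -/
theorem normalized_eq (V : ι → ι → K) (o : ι) (z : ι → K) (hz : z o = 1)
    (hV : ∀ x, x ∈ Submodule.span K (Set.range V) ↔ x = x o • z) : normalized V o = z := by
  have hVj : ∀ j, V j = V j o • z := fun j => (hV _).1 (Submodule.subset_span ⟨j, rfl⟩)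
  funext i
  rcases pivot_cases (fun j => V j o) V Finset.univ.toList with ⟨h0, -⟩ | ⟨j, -, hj, h1, h2⟩
  · have : z ∈ Submodule.span K (Set.range V) := (hV z).2 (by rw [hz, one_smul])
    rw [Submodule.mem_span_range_iff_exists_fun] at this
    obtain ⟨d, hd⟩ := this
    have h := congrFun hd o
    have h0' : ∀ j, V j o = 0 := fun j => h0 j (by simp)
    simp [hz, h0'] at h
  · rw [normalized, h1, h2, hVj j]
    simp only [Pi.smul_apply, smul_eq_mul, hz, mul_one]
    rw [mul_div_cancel_left₀ _ hj]

end Elimination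

/-! ### Cost of elimination -/

section EliminationCost

/-- The entries of a matrix of functions. -/
def entries {X K ι : Type*} (V : X → ι → ι → K) : Set (X → K) :=
  Set.range fun (p : ι × ι) x => V x p.1 p.2

theorem mem_entries {X K ι : Type*} (V : X → ι → ι → K) (j i : ι) :
    (fun x => V x j i) ∈ entries V := ⟨(j, i), rfl⟩

variable {X K ι : Type*} [Field K] {A : Set (X → K)}

theorem Cost.pivot (hA : A.Nonempty) (c : ι → X → K) (hc : ∀ j, c j ∈ A) (l : List ι) :
    Cost A (l.length + 1) {fun x => CSS.pivot (fun j => c j x) l} := by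
  classical
  induction l with
  | nil => exact Cost.const hA 0
  | cons j l ih =>
    simp only [CSS.pivot]
    exact (Cost.op (fun a b => if a = 0 then b else a) (.mem (hc j)) ih).le (by simp)

theorem Cost.pivotVec (hA : A.Nonempty) (c : ι → X → K) (hc : ∀ j, c j ∈ A) (V : X → ι → ι → K)
    (i : ι) (hV : ∀ j, (fun x => V x j i) ∈ A) (l : List ι) :
    Cost A (3 * l.length + 1) {fun x => CSS.pivotVec (fun j => c j x) (V x) l i} := by
  classical
  induction l with
  | nil => exact Cost.const hA 0
  | cons j l ih =>
    have := Cost.op (· + ·) (Cost.op (fun a b => if a = 0 then b else 0) (.mem (hc j)) ih)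
      (Cost.op (fun a b => if a = 0 then 0 else b) (.mem (hc j)) (.mem (hV j)))
    simp only [CSS.pivotVec]
    refine (this.mono subset_rfl (le_of_eq (by simp; ring)) ?_)
    rw [Set.singleton_subset_iff, Set.mem_singleton_iff]
    funext x
    split_ifs <;> simp

variable [Fintype ι]

theorem Cost.eliminate (hA : A.Nonempty) (a : X → ι → K) (V : X → ι → ι → K)
    (ha : ∀ i, (fun x => a x i) ∈ A) (hV : entries V ⊆ A) :
    Cost A (12 * Fintype.card ι ^ 2 + 1) (entries fun x => CSS.eliminate (a x) (V x)) := by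
  have hV' : ∀ j i, (fun x => V x j i) ∈ A := fun j i => hV (mem_entries V j i)
  set c : ι → X → K := fun j x => ∑ l, a x l * V x j l with hc
  have h1 : Cost A (Fintype.card ι * (Fintype.card ι * 2 + 1)) (Set.range c) := by
    refine Cost.range _ fun j => ?_
    exact Cost.sum hA Finset.univ (fun l x => a x l * V x j l) fun l _ =>
      Cost.op (· * ·) (.mem (ha l)) (.mem (hV' j l))
  have hA' : (A ∪ Set.range c).Nonempty := hA.mono Set.subset_union_left
  have hl : (Finset.univ : Finset ι).toList.length = Fintype.card ι := by simp
  have h2 := Cost.pivot hA' c (fun j => .inr ⟨j, rfl⟩) Finset.univ.toList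
  have h3 := Cost.range (fun i x => CSS.pivotVec (fun j => c j x) (V x) Finset.univ.toList i)
    fun i => Cost.pivotVec hA' c (fun j => .inr ⟨j, rfl⟩) V i (fun j => .inl (hV' j i))
      Finset.univ.toList
  rw [hl] at h2 h3
  refine (h1.trans ((h2.union h3).trans (t := _) (s := Fintype.card (ι × ι) * 3) ?_)).le ?_
  · refine Cost.range _ fun ⟨j, i⟩ => ?_
    refine (Cost.op (· - ·) (.mem (.inl (.inl (hV' j i)))) (Cost.op (· * ·)
      (Cost.op (· / ·) (.mem (.inl (.inr ⟨j, rfl⟩))) (.mem (.inr (.inl rfl))))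
      (.mem (.inr (.inr ⟨i, rfl⟩)))))
  · rw [Fintype.card_prod]
    nlinarith [Nat.le_self_pow (two_ne_zero) (Fintype.card ι)]

theorem Cost.foldl_eliminate (hA : A.Nonempty) (eqs : List (X → ι → K)) (V : X → ι → ι → K)
    (he : ∀ a ∈ eqs, ∀ i, (fun x => a x i) ∈ A) (hV : entries V ⊆ A) :
    Cost A (eqs.length * (12 * Fintype.card ι ^ 2 + 1))
      (entries fun x => (eqs.map fun a => a x).foldl (fun V a => CSS.eliminate a V) (V x)) := by
  induction eqs generalizing V A with
  | nil => exact .of_subset hV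
  | cons a eqs ih =>
    simp only [List.map_cons, List.foldl_cons, List.length_cons]
    have h1 := Cost.eliminate hA a V (he a (by simp)) hV
    refine (h1.trans (ih (hA.mono Set.subset_union_left) _
      (fun b hb i => .inl (he b (by simp [hb]) i)) Set.subset_union_right)).le (le_of_eq ?_)
    ring

theorem Cost.solutions [DecidableEq ι] (hA : A.Nonempty) (eqs : List (X → ι → K))
    (he : ∀ a ∈ eqs, ∀ i, (fun x => a x i) ∈ A) :
    Cost A ((eqs.length + 1) * (12 * Fintype.card ι ^ 2 + 1))
      (entries fun x => CSS.solutions (eqs.map fun a => a x)) := by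
  have h1 : Cost A (Fintype.card (ι × ι) * 1)
      (entries fun (_ : X) (j : ι) => (Pi.single j 1 : ι → K)) :=
    Cost.range _ fun p => Cost.const hA _
  refine (h1.trans (Cost.foldl_eliminate (hA.mono Set.subset_union_left) eqs _
    (fun a ha i => .inl (he a ha i)) Set.subset_union_right)).le ?_
  rw [Fintype.card_prod]
  nlinarith

theorem Cost.normalized (hA : A.Nonempty) (V : X → ι → ι → K) (hV : entries V ⊆ A) (o : ι) :
    Cost A (6 * Fintype.card ι ^ 2 + 1)
      (Set.range fun i x => CSS.normalized (V x) o i) := by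
  have hV' : ∀ j i, (fun x => V x j i) ∈ A := fun j i => hV (mem_entries V j i)
  have hl : (Finset.univ : Finset ι).toList.length = Fintype.card ι := by simp
  have h2 := Cost.pivot hA (fun j x => V x j o) (fun j => hV' j o) Finset.univ.toList
  have h3 := Cost.range (fun i x => CSS.pivotVec (fun j => V x j o) (V x) Finset.univ.toList i)
    fun i => Cost.pivotVec hA _ (fun j => hV' j o) V i (fun j => (hV' j i))
      Finset.univ.toList
  rw [hl] at h2 h3
  refine ((h2.union h3).trans (s := Fintype.card ι * 1) ?_).le ?_
  · exact Cost.range _ fun i => Cost.op (· / ·) (.mem (.inr (.inr ⟨i, rfl⟩)))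
      (.mem (.inr (.inl rfl)))
  · nlinarith [Nat.le_self_pow (two_ne_zero) (Fintype.card ι)]

end EliminationCost

/-! ### Reed–Solomon codes and their decoding -/

section ReedSolomon

variable {K : Type*} [Field K] [Fintype K]

/-- The `m`-th syndrome of a word whose positions are labelled by the elements of the field. -/
def powerSum (y : K → K) (m : ℕ) : K := ∑ α, α ^ m * y α

theorem powerSum_sub (x y : K → K) (m : ℕ) : powerSum (x - y) m = powerSum x m - powerSum y m := by
  simp [powerSum, mul_sub]

theorem sum_eval_mul_eq_zero {x : K → K} {d : ℕ} (hx : ∀ m < d, powerSum x m = 0)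
    (p : Polynomial K) (hp : p.natDegree < d) : ∑ α, p.eval α * x α = 0 := by
  simp_rw [Polynomial.eval_eq_sum_range' hp, Finset.sum_mul]
  rw [Finset.sum_comm]
  refine Finset.sum_eq_zero fun m hm => ?_
  have := hx m (Finset.mem_range.1 hm)
  rw [powerSum] at this
  simp_rw [mul_assoc, ← Finset.mul_sum, this, mul_zero]

/-- A word supported on at most `d` positions is determined by its first `d` syndromes. -/
theorem eq_zero_of_powerSum {x : K → K} (Z : Finset K) (hZ : ∀ α ∉ Z, x α = 0) {d : ℕ}
    (hd : Z.card ≤ d) (hx : ∀ m < d, powerSum x m = 0) : x = 0 := by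
  classical
  funext γ
  by_cases hγ : γ ∈ Z
  -- This polynomial kills every position of `Z` except `γ`, and its degree `Z.card - 1` is small
  -- enough to pair to zero with `x`.
  · set p : Polynomial K := ∏ β ∈ Z.erase γ, (Polynomial.X - Polynomial.C β) with hp
    have hdeg : p.natDegree < d := by
      rw [hp, Polynomial.natDegree_finsetProd_X_sub_C_eq_card, Finset.card_erase_of_mem hγ]
      have := Finset.card_pos.2 ⟨γ, hγ⟩
      omega
    have h := sum_eval_mul_eq_zero hx p hdeg
    rw [Finset.sum_eq_single γ] at h
    · refine (mul_eq_zero.1 h).resolve_left ?_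
      rw [hp, Polynomial.eval_prod, ← ne_eq, Finset.prod_ne_zero_iff]
      intro β hβ
      simpa [sub_eq_zero] using (Finset.ne_of_mem_erase hβ).symm
    · intro β _ hβ
      by_cases hβZ : β ∈ Z
      · rw [hp, Polynomial.eval_prod, Finset.prod_eq_zero (Finset.mem_erase.2 ⟨hβ, hβZ⟩) (by simp),
          zero_mul]
      · rw [hZ β hβZ, mul_zero]
    · simp
  · exact hZ γ hγ

/-- The equations for the coefficients of the error locator polynomials of degree at most `t`. -/
def locatorEquations (t : ℕ) (S : ℕ → K) : List (Fin (t + 1) → K) :=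
  (List.range t).map fun b l => S (l + b)

open Classical in
/-- The equations for the multiples `(c, c e)` of the error word `e`, with syndromes `S` and
supported on the common zeros of the polynomials with coefficients `V j`. -/
noncomputable def errorEquations (d t : ℕ) (S : ℕ → K) (V : Fin (t + 1) → Fin (t + 1) → K) :
    List (Option K → K) :=
  (List.range d).map (fun m o => o.elim (-S m) fun α => α ^ m) ++
    (Finset.univ : Finset (Fin (t + 1) × K)).toList.map fun p o =>
      o.elim 0 fun α => if α = p.2 then ∑ l, V p.1 l * α ^ (l : ℕ) else 0

open Classical in
/-- Decoding of the Reed–Solomon code with `d` checks by an error locating pair: the estimate of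
the error word, given any word with the same syndromes. -/
noncomputable def rsDecode (d t : ℕ) (y : K → K) : K → K := fun α =>
  normalized (solutions (errorEquations d t (powerSum y)
    (solutions (locatorEquations t (powerSum y))))) none (some α)

-- Two linear systems suffice. The first finds the polynomials of degree at most `t` that vanish on
-- the support `I` of the error: `a` satisfies it when the word `a(α) e(α)`, supported on at most
-- `t` positions, has its first `t` syndromes zero. The second asks for words supported on the
-- common zeros of these polynomials, which are exactly `I`, with syndromes proportional to those of
-- `y`. Its solutions are the multiples of `(1, e)`.
open Classical in
theorem rsDecode_eq {d t : ℕ} (htd : 2 * t ≤ d) {y e : K → K}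
    (hye : ∀ m < d, powerSum y m = powerSum e m)
    (he : (Finset.univ.filter fun α => e α ≠ 0).card ≤ t) : rsDecode d t y = e := by
  set I := Finset.univ.filter fun α => e α ≠ 0 with hI
  have hIe : ∀ α ∉ I, e α = 0 := by simp [hI]
  set V := solutions (locatorEquations t (powerSum y)) with hV
  let ev : (Fin (t + 1) → K) → K → K := fun a α => ∑ l, a l * α ^ (l : ℕ)
  have hloc : ∀ a, a ∈ Submodule.span K (Set.range V) ↔ ∀ α, ev a α * e α = 0 := by
    intro a
    have h1 : a ∈ Submodule.span K (Set.range V) ↔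
        ∀ b < t, powerSum (fun α => ev a α * e α) b = 0 := by
      rw [hV, mem_span_solutions, locatorEquations]
      simp only [List.forall_mem_map, List.mem_range]
      refine forall₂_congr fun b hb => ?_
      rw [← eq_iff_iff]
      congr 1
      -- Here `l + b ≤ 2 * t - 1 < d`, so only syndromes shared by `y` and `e` occur.
      rw [Finset.sum_congr rfl fun (l : Fin (t + 1)) _ => by rw [hye (l + b) (by omega)]]
      simp only [powerSum, ev, Finset.sum_mul, Finset.mul_sum]
      rw [Finset.sum_comm]
      exact Finset.sum_congr rfl fun l _ => Finset.sum_congr rfl fun α _ => by ring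
    rw [h1]
    constructor
    · intro h α
      exact congrFun (eq_zero_of_powerSum I (fun α hα => by simp [hIe α hα]) he h) α
    · intro h b _
      simp [powerSum, h]
  -- The error locator polynomial: its degree `I.card ≤ t` admits it to the span of `V`, and it
  -- vanishes nowhere outside `I`.
  set p : Polynomial K := ∏ β ∈ I, (Polynomial.X - Polynomial.C β) with hp
  have hpe : ∀ α, ev (fun l => p.coeff l) α = p.eval α := by
    intro α
    rw [Polynomial.eval_eq_sum_range' (n := t + 1), ← Fin.sum_univ_eq_sum_range
      fun l => p.coeff l * α ^ l]
    rw [hp, Polynomial.natDegree_finsetProd_X_sub_C_eq_card]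
    omega
  have hpI : ∀ α, p.eval α = 0 ↔ α ∈ I := by
    intro α
    rw [hp, Polynomial.eval_prod, Finset.prod_eq_zero_iff]
    simp [sub_eq_zero]
  have hpV : (fun l : Fin (t + 1) => p.coeff l) ∈ Submodule.span K (Set.range V) := by
    rw [hloc]
    intro α
    rw [hpe]
    by_cases hα : α ∈ I
    · rw [(hpI α).2 hα, zero_mul]
    · rw [hIe α hα, mul_zero]
  funext α
  have key : normalized (solutions (errorEquations d t (powerSum y) V)) none =
      fun o => o.elim 1 e := by
    refine normalized_eq _ _ _ rfl fun x => ?_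
    rw [mem_span_solutions, errorEquations]
    simp only [List.mem_append, or_imp, forall_and, List.forall_mem_map, List.mem_range,
      Finset.mem_toList, Finset.mem_univ, forall_true_left, Fintype.sum_option, Option.elim_none,
      Option.elim_some, zero_mul, zero_add, ite_mul, Finset.sum_ite_eq', if_true, Prod.forall]
    constructor
    · rintro ⟨h1, h2⟩
      have h3 : ∀ α ∉ I, x (some α) = 0 := by
        intro α hα
        have h4 : ∀ a ∈ Submodule.span K (Set.range V), ev a α * x (some α) = 0 := by
          intro a ha
          rw [Submodule.mem_span_range_iff_exists_fun] at ha
          obtain ⟨c, rfl⟩ := ha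
          simp only [ev, Finset.sum_apply, Pi.smul_apply, smul_eq_mul, Finset.sum_mul]
          rw [Finset.sum_comm]
          refine Finset.sum_eq_zero fun j _ => ?_
          have := h2 j α
          rw [Finset.sum_mul] at this
          simp_rw [mul_assoc, ← Finset.mul_sum, ← mul_assoc, this, mul_zero]
        have h5 := h4 _ hpV
        rw [hpe] at h5
        exact (mul_eq_zero.1 h5).resolve_left fun h => hα ((hpI α).1 h)
      have h6 : (fun α => x (some α) - x none * e α) = 0 := by
        refine eq_zero_of_powerSum I (fun α hα => ?_) (d := d) (by omega) fun m hm => ?_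
        · rw [h3 α hα, hIe α hα, mul_zero, sub_zero]
        · have h7 := h1 m hm
          rw [hye m hm] at h7
          simp only [powerSum, mul_sub, Finset.sum_sub_distrib] at h7 ⊢
          rw [eq_neg_of_add_eq_zero_right h7, neg_mul, neg_neg, mul_comm, Finset.mul_sum, sub_eq_zero]
          exact Finset.sum_congr rfl fun α _ => by ring
      funext o
      cases o with
      | none => simp
      | some α => simpa [sub_eq_zero] using congrFun h6 α
    · intro hx
      have hxs : ∀ α, x (some α) = x none * e α := fun α => by
        simpa using congrFun hx (some α)
      constructor
      · intro m hm
        simp only [hxs]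
        rw [hye m hm, powerSum, neg_mul, Finset.sum_mul, neg_add_eq_zero]
        exact Finset.sum_congr rfl fun α _ => by ring
      · intro j α
        have := (hloc (V j)).1 (Submodule.subset_span ⟨j, rfl⟩) α
        rw [hxs, mul_left_comm, this, mul_zero]
  rw [rsDecode, ← hV, key]
  rfl

open Classical in
theorem Cost.rsDecode {X : Type*} {A : Set (X → K)} {d t : ℕ} (htd : 2 * t ≤ d)
    (hd : d ≤ Fintype.card K) (y : X → K → K) (hy : ∀ α, (fun x => y x α) ∈ A) :
    Cost A (70 * (Fintype.card K + 1) ^ 4) (Set.range fun α x => CSS.rsDecode d t (y x) α) := by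
  have hA : A.Nonempty := ⟨_, hy 0⟩
  have h1 : Cost A (Fintype.card (Fin d) * (Fintype.card K * (1 + 1) + 1))
      (Set.range fun (m : Fin d) x => powerSum (y x) m) := by
    refine Cost.range _ fun m => ?_
    exact Cost.sum hA Finset.univ (fun α x => α ^ (m : ℕ) * y x α) fun α _ =>
      Cost.op (fun a _ => α ^ (m : ℕ) * a) (.mem (hy α)) (.mem (hy α))
  set A₁ := A ∪ (Set.range fun (m : Fin d) x => powerSum (y x) m) with hA₁
  have hA₁n : A₁.Nonempty := hA.mono Set.subset_union_left
  have hS : ∀ m < d, (fun x => powerSum (y x) m) ∈ A₁ := fun m hm => .inr ⟨⟨m, hm⟩, rfl⟩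
  have h2 := Cost.solutions hA₁n
    ((List.range t).map fun b x (l : Fin (t + 1)) => powerSum (y x) (l + b)) (by
      simp only [List.forall_mem_map, List.mem_range]
      exact fun b hb l => hS _ (by omega))
  simp only [List.map_map, Function.comp_def, List.length_map, List.length_range] at h2
  set V : X → Fin (t + 1) → Fin (t + 1) → K :=
    fun x => CSS.solutions (locatorEquations t (powerSum (y x))) with hV
  set A₂ := A₁ ∪ entries V with hA₂
  have hA₂n : A₂.Nonempty := hA₁n.mono Set.subset_union_left
  have h3 : Cost A₂ (Fintype.card (Fin d × Option K) * 1)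
      (Set.range fun (p : Fin d × Option K) (x : X) =>
        p.2.elim (-powerSum (y x) p.1) fun α => α ^ (p.1 : ℕ)) := by
    refine Cost.range _ ?_
    rintro ⟨m, _ | α⟩
    · exact Cost.op (fun a _ => -a) (.mem (.inl (hS m m.2))) (.mem (.inl (hS m m.2)))
    · exact Cost.const hA₂n _
  have h4 : Cost A₂ (Fintype.card ((Fin (t + 1) × K) × Option K) * ((t + 1) * 2 + 1))
      (Set.range fun (p : (Fin (t + 1) × K) × Option K) (x : X) => p.2.elim 0 fun α =>
        if α = p.1.2 then ∑ l, V x p.1.1 l * α ^ (l : ℕ) else 0) := by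
    refine Cost.range _ ?_
    rintro ⟨⟨j, β⟩, _ | α⟩
    · exact (Cost.const hA₂n _).le (by omega)
    · by_cases hα : α = β
      · simp only [Option.elim_some, hα, if_true]
        have := Cost.sum hA₂n Finset.univ (fun l x => V x j l * β ^ (l : ℕ)) fun l _ =>
          Cost.op (fun a _ => a * β ^ (l : ℕ)) (.mem (.inr (mem_entries V j l)))
            (.mem (.inr (mem_entries V j l)))
        simpa using this
      · simp only [Option.elim_some, hα, if_false]
        exact (Cost.const hA₂n _).le (by omega)
  have h34 := h3.union h4
  set C := (Set.range fun (p : Fin d × Option K) (x : X) =>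
        p.2.elim (-powerSum (y x) p.1) fun α => α ^ (p.1 : ℕ)) ∪
      (Set.range fun (p : (Fin (t + 1) × K) × Option K) (x : X) => p.2.elim 0 fun α =>
        if α = p.1.2 then ∑ l, V x p.1.1 l * α ^ (l : ℕ) else 0) with hC
  have hCn : (A₂ ∪ C).Nonempty := hA₂n.mono Set.subset_union_left
  have h5 := Cost.solutions hCn
    ((List.range d).map (fun m (x : X) (o : Option K) =>
      o.elim (-powerSum (y x) m) fun α => α ^ m) ++
    (Finset.univ : Finset (Fin (t + 1) × K)).toList.map fun p x o =>
      o.elim 0 fun α => if α = p.2 then ∑ l, V x p.1 l * α ^ (l : ℕ) else 0) (by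
      simp only [List.mem_append, or_imp, forall_and, List.forall_mem_map, List.mem_range]
      exact ⟨fun m hm o => .inr (.inl ⟨(⟨m, hm⟩, o), rfl⟩), fun p _ o => .inr (.inr ⟨(p, o), rfl⟩)⟩)
  simp only [List.map_append, List.map_map, Function.comp_def, List.length_append, List.length_map,
    List.length_range, Finset.length_toList, Finset.card_univ] at h5
  have h6 := Cost.normalized (hCn.mono Set.subset_union_left) _
    (Set.subset_union_right (s := A₂ ∪ C)
      (t := entries fun x => CSS.solutions (errorEquations d t (powerSum (y x)) (V x)))) none
  refine (h1.trans (h2.trans (h34.trans (h5.trans h6)))).mono subset_rfl ?_ ?_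
  · simp only [Fintype.card_prod, Fintype.card_option, Fintype.card_fin]
    obtain ⟨P, hP⟩ : ∃ P, P = Fintype.card K + 1 := ⟨_, rfl⟩
    obtain ⟨N, hN⟩ : ∃ N, N = Fintype.card K := ⟨_, rfl⟩
    rw [← hN] at hP hd ⊢
    rw [← hP]
    have e1 : N ≤ P := by omega
    have e2 : t + 1 ≤ P := by omega
    have e3 : d ≤ P := by omega
    have e0 : 1 ≤ P := by omega
    have p2 : P ≤ P ^ 4 := Nat.le_self_pow (by norm_num) P
    have p3 : P ^ 2 ≤ P ^ 4 := Nat.pow_le_pow_right e0 (by norm_num)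
    have p4 : P ^ 3 ≤ P ^ 4 := Nat.pow_le_pow_right e0 (by norm_num)
    have p5 : 1 ≤ P ^ 4 := Nat.one_le_pow _ _ e0
    calc _ ≤ P * (P * (1 + 1) + 1) + (P * (12 * P ^ 2 + 1) + (P * P * 1 + P * P * P * (P * 2 + 1) +
          ((P + P * P + 1) * (12 * P ^ 2 + 1) + (6 * P ^ 2 + 1)))) := by
            gcongr
      _ ≤ 70 * P ^ 4 := by ring_nf; nlinarith
  · rintro _ ⟨α, rfl⟩
    exact ⟨some α, rfl⟩

end ReedSolomon

/-! ### Duality for the dot product -/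

section Dual

variable {F : Type*} [Field F] {n : ℕ}

theorem mem_dual {C : Submodule F (Fin n → F)} {y : Fin n → F} :
    y ∈ dual C ↔ ∀ x ∈ C, x ⬝ᵥ y = 0 := Iff.rfl

theorem dual_anti {C D : Submodule F (Fin n → F)} (h : C ≤ D) : dual D ≤ dual C :=
  fun _ hy x hx => hy x (h hx)

theorem dual_eq_orthogonal (C : Submodule F (Fin n → F)) :
    dual C = LinearMap.BilinForm.orthogonal (dotProductBilin F F) C := by
  ext y
  simp [mem_dual, LinearMap.BilinForm.mem_orthogonal_iff]

theorem nondegenerate_dotProduct :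
    (dotProductBilin F F : LinearMap.BilinForm F (Fin n → F)).Nondegenerate := by
  constructor
  · intro x hx
    exact dotProduct_eq_zero_iff.1 fun w => by simpa using hx w
  · intro x hx
    exact dotProduct_eq_zero_iff.1 fun w => by simpa [dotProduct_comm] using hx w

theorem isRefl_dotProduct :
    LinearMap.BilinForm.IsRefl (dotProductBilin F F : LinearMap.BilinForm F (Fin n → F)) := by
  intro x y h
  simpa [dotProduct_comm] using h

theorem finrank_dual_add (C : Submodule F (Fin n → F)) :
    Module.finrank F (dual C) + Module.finrank F C = n := by
  rw [dual_eq_orthogonal, LinearMap.BilinForm.finrank_orthogonal nondegenerate_dotProduct]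
  have := Submodule.finrank_le C
  simp only [Module.finrank_fin_fun] at this ⊢
  omega

theorem dual_dual (C : Submodule F (Fin n → F)) : dual (dual C) = C := by
  rw [dual_eq_orthogonal, dual_eq_orthogonal,
    LinearMap.BilinForm.orthogonal_orthogonal nondegenerate_dotProduct isRefl_dotProduct]

theorem CodePair.dual_le (C : CodePair F n) (j : Fin 2) : dual (C.code j.rev) ≤ C.code j := by
  fin_cases j
  · exact C.css
  · have := dual_anti C.css
    rwa [dual_dual] at this

/-- A basis of the dual code serves as the rows, and biduality identifies the kernel. -/
theorem exists_parityCheck (C : Submodule F (Fin n → F)) :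
    ∃ (m : ℕ) (H : Matrix (Fin m) (Fin n) F), m ≤ n ∧ LinearIndependent F H.row ∧
      ∀ x, x ∈ C ↔ H.mulVec x = 0 := by
  let b := Module.finBasis F (dual C)
  refine ⟨_, Matrix.of fun i => (b i : Fin n → F), ?_, ?_, fun x => ?_⟩
  · exact (Submodule.finrank_le _).trans (by simp)
  · exact b.linearIndependent.map' (dual C).subtype (by simp)
  · conv_lhs => rw [← dual_dual C, mem_dual]
    constructor
    · intro h
      funext i
      exact h _ (b i).2
    · intro h y hy
      have hy' : y = ∑ i, b.repr ⟨y, hy⟩ i • (b i : Fin n → F) := by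
        have := congrArg (dual C).subtype (b.sum_repr ⟨y, hy⟩)
        rw [map_sum] at this
        exact this.symm
      rw [hy', sum_dotProduct]
      refine Finset.sum_eq_zero fun i _ => ?_
      rw [smul_dotProduct]
      have : (b i : Fin n → F) ⬝ᵥ x = 0 := congrFun h i
      rw [this, smul_zero]

end Dual

/-! ### Syndrome decoders from coset representatives -/

theorem Cost.comp {X Y α : Type*} {A B : Set (X → α)} {t : ℕ} (h : Cost A t B) (u : Y → X) :
    Cost ((fun f => f ∘ u) '' A) t ((fun f => f ∘ u) '' B) := by
  obtain ⟨s, hs, Z, hZ, hBZ⟩ := h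
  refine ⟨s, hs, (fun f => f ∘ u) '' Z, ?_, Set.image_mono hBZ⟩
  clear hs hBZ
  induction hZ with
  | refl => exact .refl _
  | step op _ hf hg ih =>
    rw [Set.image_insert_eq]
    exact .step op ih ⟨_, hf, rfl⟩ ⟨_, hg, rfl⟩

/-- The functions available at the start of a program with input in `F^m`. -/
def inputs (F : Type*) [Zero F] (m : ℕ) : Set ((Fin m → F) → F) :=
  insert (fun _ => 0) (Set.range fun i s => s i)

theorem inputs_nonempty (F : Type*) [Zero F] (m : ℕ) : (inputs F m).Nonempty :=
  Set.insert_nonempty _ _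

/-- A function of a coset representative of the error pattern gives a syndrome decoder. -/
theorem exists_syndromeDecoder {F : Type*} [Field F] {n t : ℕ} (C : Submodule F (Fin n → F))
    (g : (Fin n → F) → Fin n → F) (hg : Cost (inputs F n) t (Set.range fun i s => g s i)) :
    ∃ D : SyndromeDecoder C, D.RunsIn (4 * (n + 1) ^ 2 + t) ∧
      ∀ e, ∃ e', e - e' ∈ C ∧ D.estimate (D.H.mulVec e) = g e' := by
  obtain ⟨m, H, hm, hH, hC⟩ := exists_parityCheck C
  -- A linear section of the syndrome map turns a syndrome into a word with that syndrome. It is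
  -- extended to all of `F^m`, so that its coordinates are sums of multiples of the inputs.
  obtain ⟨B, hB⟩ := H.mulVecLin.rangeRestrict.exists_rightInverse_of_surjective
    (LinearMap.range_rangeRestrict _)
  obtain ⟨A, hA⟩ := LinearMap.exists_extend B
  have hAH : ∀ e, H.mulVec (A (H.mulVec e)) = H.mulVec e := by
    intro e
    have h1 : A (H.mulVec e) = B ⟨H.mulVec e, ⟨e, rfl⟩⟩ := LinearMap.congr_fun hA ⟨H.mulVec e, ⟨e, rfl⟩⟩
    have h2 := congrArg Subtype.val (LinearMap.congr_fun hB ⟨H.mulVec e, ⟨e, rfl⟩⟩)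
    rw [h1]
    exact h2
  refine ⟨⟨m, H, hH, hC, fun s => g (A s)⟩, ?_, fun e => ⟨A (H.mulVec e), ?_, rfl⟩⟩
  · have h1 : Cost (inputs F m) (Fintype.card (Fin n) * (m * 2 + 1))
        (Set.range fun i s => A s i) := by
      refine Cost.range _ fun i => ?_
      have := Cost.sum (inputs_nonempty F m) Finset.univ
        (fun j s => s j * A (Pi.single j 1) i) fun j _ =>
          Cost.op (fun a _ => a * A (Pi.single j 1) i) (.mem (.inr ⟨j, rfl⟩)) (.mem (.inr ⟨j, rfl⟩))
      have he : (fun s => A s i) = fun s => ∑ j, s j * A (Pi.single j 1) i := by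
        funext s
        rw [LinearMap.pi_apply_eq_sum_univ A s]
        simp only [Finset.sum_apply, Pi.smul_apply, smul_eq_mul]
        refine Finset.sum_congr rfl fun j _ => ?_
        congr 2
        refine congrFun (congrArg A (funext fun l => ?_)) i
        simp [Pi.single_apply, eq_comm]
      rw [he]
      simpa using this
    have h2 : Cost (inputs F m ∪ Set.range fun i s => A s i) t
        (Set.range fun i s => g (A s) i) := by
      refine (hg.comp A).mono ?_ le_rfl ?_
      · rintro _ ⟨f, rfl | ⟨i, rfl⟩, rfl⟩
        · exact .inl (.inl rfl)
        · exact .inr ⟨i, rfl⟩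
      · rintro _ ⟨i, rfl⟩
        exact ⟨_, ⟨i, rfl⟩, rfl⟩
    obtain ⟨P, hP, hrun⟩ := (h1.trans h2).exists_program (fun s => g (A s))
    refine ⟨P, hP.trans ?_, hrun⟩
    rw [Fintype.card_fin]
    nlinarith [Nat.mul_le_mul_left n hm]
  · rw [hC, Matrix.mulVec_sub, hAH, sub_self]

/-! ### Field coordinates on the two quotients -/

/-- Coordinates in a field extension `K` for the quotient codes of a code pair. -/
structure Frame {F : Type*} [Field F] {n : ℕ} (C : CodePair F n) (K : Type*) [Field K]
    [Algebra F K] (l : K →ₗ[F] F) where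
  coord : Fin 2 → (Fin n → F) →ₗ[F] K
  lift : Fin 2 → K →ₗ[F] (Fin n → F)
  lift_mem : ∀ j z, lift j z ∈ C.code j
  coord_lift : ∀ j z, coord j (lift j z) = z
  coord_eq_zero : ∀ j, ∀ x ∈ C.code j, coord j x = 0 ↔ x ∈ dual (C.code j.rev)
  dotProduct_eq : ∀ x ∈ C.code 0, ∀ y ∈ C.code 1, x ⬝ᵥ y = l (coord 0 x * coord 1 y)

/-- The form `l (w * z)` is nondegenerate: if it vanished for all `w` and some `z ≠ 0`, dividing by
`z` would give `l = 0`. -/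
theorem exists_equiv_dual {F K : Type*} [Field F] [Field K] [Algebra F K] [FiniteDimensional F K]
    {l : K →ₗ[F] F} (hl : l ≠ 0) :
    ∃ θ : K ≃ₗ[F] Module.Dual F K, ∀ z w, θ z w = l (w * z) := by
  let T : K →ₗ[F] Module.Dual F K := (LinearMap.mul F K).flip.compr₂ l
  have hT : ∀ z w, T z w = l (w * z) := fun z w => by simp [T, mul_comm]
  have hinj : Function.Injective T := by
    rw [injective_iff_map_eq_zero]
    intro z hz
    by_contra hz0
    refine hl (LinearMap.ext fun w => ?_)
    have := hT z (w / z)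
    rw [hz, div_mul_cancel₀ _ hz0] at this
    simpa using this.symm
  exact ⟨LinearEquiv.ofInjectiveOfFinrankEq T hinj (by simp), hT⟩

/-- Coordinates on the first quotient are arbitrary. Those on the second are forced by adjointness,
`l (w * φ₁ y) = s₀ w ⬝ᵥ y`, and exist because `l (w * z)` identifies `K` with its dual. -/
theorem exists_frame {F : Type*} [Field F] {n : ℕ} (C : CodePair F n) (K : Type*) [Field K]
    [Algebra F K] [FiniteDimensional F K] {l : K →ₗ[F] F} (hl : l ≠ 0)
    (hk : Module.finrank F (C.code 0) + Module.finrank F (C.code 1) = n + Module.finrank F K) :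
    Nonempty (Frame C K l) := by
  set C₀ := C.code 0
  set C₁ := C.code 1
  have d0 := finrank_dual_add C₀
  have d1 := finrank_dual_add C₁
  have e1 : Module.finrank F ((dual C₁).comap C₀.subtype) = Module.finrank F (dual C₁) :=
    (Submodule.comapSubtypeEquivOfLe C.css).finrank_eq
  have hq := Submodule.finrank_quotient_add_finrank ((dual C₁).comap C₀.subtype)
  obtain ⟨ε⟩ : Nonempty ((C₀ ⧸ (dual C₁).comap C₀.subtype) ≃ₗ[F] K) :=
    FiniteDimensional.nonempty_linearEquiv_of_finrank_eq (by omega)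
  let f : C₀ →ₗ[F] K := ε.toLinearMap ∘ₗ Submodule.mkQ _
  have hf : Function.Surjective f := ε.surjective.comp (Submodule.mkQ_surjective _)
  have hf0 : ∀ x : C₀, f x = 0 ↔ (x : Fin n → F) ∈ dual C₁ := by
    intro x
    simp [f, Submodule.Quotient.mk_eq_zero]
  obtain ⟨φ₀, hφ₀⟩ := LinearMap.exists_extend f
  obtain ⟨r, hr⟩ := f.exists_rightInverse_of_surjective (LinearMap.range_eq_top.2 hf)
  let s₀ : K →ₗ[F] (Fin n → F) := C₀.subtype ∘ₗ r
  have hφ₀' : ∀ x : C₀, φ₀ x = f x := fun x => LinearMap.congr_fun hφ₀ x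
  have hs₀ : ∀ z, s₀ z ∈ C₀ := fun z => (r z).2
  have hφs : ∀ z, φ₀ (s₀ z) = z := fun z => (hφ₀' (r z)).trans (LinearMap.congr_fun hr z)
  have hk₀ : ∀ x ∈ C₀, φ₀ x = 0 ↔ x ∈ dual C₁ := fun x hx => by
    rw [← hf0 ⟨x, hx⟩, ← hφ₀']
  obtain ⟨θ, hθ⟩ := exists_equiv_dual (F := F) (K := K) hl
  let T : (Fin n → F) →ₗ[F] Module.Dual F K := (dotProductBilin F F).flip.compl₂ s₀
  have hT : ∀ y z, T y z = s₀ z ⬝ᵥ y := fun y z => by simp [T]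
  let φ₁ : (Fin n → F) →ₗ[F] K := θ.symm.toLinearMap ∘ₗ T
  have hφ₁ : ∀ y w, l (w * φ₁ y) = s₀ w ⬝ᵥ y := fun y w => by
    rw [← hθ, ← hT]
    simp [φ₁]
  have hdot : ∀ x ∈ C₀, ∀ y ∈ C₁, x ⬝ᵥ y = l (φ₀ x * φ₁ y) := by
    intro x hx y hy
    rw [hφ₁]
    have h : x - s₀ (φ₀ x) ∈ dual C₁ := by
      rw [← hk₀ _ (sub_mem hx (hs₀ _)), map_sub, hφs, sub_self]
    have := h y hy
    rw [dotProduct_comm, sub_dotProduct, sub_eq_zero] at this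
    exact this
  have hk₁ : ∀ y ∈ C₁, φ₁ y = 0 ↔ y ∈ dual C₀ := by
    intro y hy
    constructor
    · intro h x hx
      rw [hdot x hx y hy, h, mul_zero, map_zero]
    · intro h
      have : T y = 0 := LinearMap.ext fun z => by rw [hT, h _ (hs₀ z)]; rfl
      simp [φ₁, this]
  have css' : dual C₀ ≤ C₁ := C.dual_le 1
  have hker : LinearMap.ker (φ₁ ∘ₗ C₁.subtype) = (dual C₀).comap C₁.subtype := by
    ext y
    simpa using hk₁ y y.2
  have e2 : Module.finrank F ((dual C₀).comap C₁.subtype) = Module.finrank F (dual C₀) :=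
    (Submodule.comapSubtypeEquivOfLe css').finrank_eq
  -- The rank of `φ₁` on `C₁` is `dim C₁ - dim C₀^⊥ = dim C₁ + dim C₀ - n`, the degree of `K`; hence
  -- surjectivity.
  have hrank := LinearMap.finrank_range_add_finrank_ker (φ₁ ∘ₗ C₁.subtype)
  rw [hker, e2] at hrank
  have hsurj : LinearMap.range (φ₁ ∘ₗ C₁.subtype) = ⊤ :=
    Submodule.eq_top_of_finrank_eq (by omega)
  obtain ⟨r', hr'⟩ := LinearMap.exists_rightInverse_of_surjective _ hsurj
  refine ⟨⟨![φ₀, φ₁], ![s₀, C₁.subtype ∘ₗ r'], ?_, ?_, ?_, hdot⟩⟩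
  · simp only [Fin.forall_fin_two]
    exact ⟨hs₀, fun z => (r' z).2⟩
  · simp only [Fin.forall_fin_two]
    exact ⟨hφs, fun z => LinearMap.congr_fun hr' z⟩
  · simp only [Fin.forall_fin_two]
    exact ⟨hk₀, hk₁⟩

/-! ### Vandermonde systems, tail bounds, consistent estimates -/

theorem exists_powerSum_eq {K : Type*} [Field K] [Fintype K] {d : ℕ} (hd : d ≤ Fintype.card K)
    (z : Fin d → K) : ∃ x : K → K, ∀ m : Fin d, powerSum x m = z m := by
  classical
  -- All `|K|` power sums together form a square system, injective and hence surjective; those not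
  -- prescribed are set to `0`.
  let T : (K → K) →ₗ[K] (Fin (Fintype.card K) → K) :=
    LinearMap.pi fun m => ∑ α : K, α ^ (m : ℕ) • LinearMap.proj α
  have hT : ∀ x m, T x m = powerSum x m := fun x m => by simp [T, powerSum]
  have hinj : Function.Injective T := by
    rw [injective_iff_map_eq_zero]
    intro x hx
    exact eq_zero_of_powerSum Finset.univ (fun α hα => absurd (Finset.mem_univ α) hα)
      Finset.card_univ.le fun m hm => by rw [← hT x ⟨m, hm⟩, hx, Pi.zero_apply]
  have hsurj := (LinearMap.injective_iff_surjective_of_finrank_eq_finrank (by simp)).1 hinj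
  obtain ⟨x, hx⟩ := hsurj fun m => if h : (m : ℕ) < d then z ⟨m, h⟩ else 0
  refine ⟨x, fun m => ?_⟩
  rw [← hT x ⟨m, m.2.trans_le hd⟩, hx]
  simp

/-- More than `t` of the independent trials fail with probability at most `2 ^ N * p ^ (t + 1)`. -/
theorem sum_prod_le_of_many {ι Y : Type*} [Fintype ι] [DecidableEq ι] [Fintype Y] (w : Y → ℝ≥0∞)
    (hw : ∑ y, w y = 1) (bad : Y → Prop) [DecidablePred bad] (t : ℕ) :
    (∑ u : ι → Y, if t < (Finset.univ.filter fun a => bad (u a)).card then ∏ a, w (u a) else 0) ≤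
      2 ^ Fintype.card ι * (∑ y, if bad y then w y else 0) ^ (t + 1) := by
  classical
  set b : Y → ℝ≥0∞ := fun y => if bad y then w y else 0 with hb
  -- Union bound over the sets `T` of `t + 1` failing trials. The trials outside `T` are
  -- unconstrained and sum to `1`.
  calc _ ≤ ∑ u : ι → Y, ∑ T ∈ Finset.powersetCard (t + 1) Finset.univ,
        ∏ a, (if a ∈ T then b (u a) else w (u a)) := by
        refine Finset.sum_le_sum fun u _ => ?_
        split_ifs with h
        · obtain ⟨T, hT, hcard⟩ := Finset.exists_subset_card_eq h
          refine le_trans (le_of_eq ?_) (Finset.single_le_sum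
            (f := fun T => ∏ a, (if a ∈ T then b (u a) else w (u a))) (fun _ _ => zero_le)
            (Finset.mem_powersetCard.2 ⟨Finset.subset_univ T, hcard⟩))
          refine Finset.prod_congr rfl fun a _ => ?_
          by_cases ha : a ∈ T
          · have := (Finset.mem_filter.1 (hT ha)).2
            simp [ha, hb, this]
          · simp [ha]
        · exact zero_le
    _ = ∑ T ∈ Finset.powersetCard (t + 1) (Finset.univ : Finset ι), (∑ y, b y) ^ (t + 1) := by
        rw [Finset.sum_comm]
        refine Finset.sum_congr rfl fun T hT => ?_
        have h1 := Finset.prod_univ_sum (fun _ : ι => (Finset.univ : Finset Y))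
          fun a y => if a ∈ T then b y else w y
        rw [Fintype.piFinset_univ] at h1
        rw [← h1]
        have h2 : ∀ a, (∑ y, if a ∈ T then b y else w y) = if a ∈ T then ∑ y, b y else 1 := by
          intro a
          split_ifs
          · rfl
          · exact hw
        simp_rw [h2]
        rw [Finset.prod_ite_mem, Finset.univ_inter, Finset.prod_const,
          (Finset.mem_powersetCard.1 hT).2]
    _ ≤ 2 ^ Fintype.card ι * (∑ y, b y) ^ (t + 1) := by
        rw [Finset.sum_const, Finset.card_powersetCard, Finset.card_univ, nsmul_eq_mul]
        gcongr
        exact_mod_cast Nat.choose_le_two_pow _ _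

theorem sum_prod_pmf {F : Type*} [Fintype F] (W : PMF F) (n : ℕ) :
    ∑ y : Fin n → F, ∏ i, W (y i) = 1 := by
  classical
  have h1 := Finset.prod_univ_sum (fun _ : Fin n => (Finset.univ : Finset F)) fun _ a => W a
  rw [Fintype.piFinset_univ] at h1
  rw [← h1]
  have : ∑ a, W a = 1 := by rw [← W.tsum_coe, tsum_fintype]
  simp [this]

/-- The estimates of a syndrome decoder can be made consistent with the syndrome. -/
theorem SyndromeDecoder.exists_consistent {F : Type*} [Field F] {n : ℕ}
    {C : Submodule F (Fin n → F)} (D : SyndromeDecoder C) :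
    ∃ est : (Fin n → F) → Fin n → F, (∀ x y, x - y ∈ C → est x = est y) ∧
      (∀ x, x - est x ∈ C) ∧ ∀ B ≤ C, ∀ x, x - D.estimate (D.H.mulVec x) ∈ B → x - est x ∈ B := by
  classical
  have hH : ∀ x y, x - y ∈ C ↔ D.H.mulVec x = D.H.mulVec y := fun x y => by
    rw [D.mem_code_iff, Matrix.mulVec_sub, sub_eq_zero]
  have hr : ∀ s : Fin D.checks → F, ∃ y, (∃ x, D.H.mulVec x = s) → D.H.mulVec y = s := fun s => by
    by_cases h : ∃ x, D.H.mulVec x = s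
    · exact ⟨h.choose, fun _ => h.choose_spec⟩
    · exact ⟨0, fun h' => absurd h' h⟩
  choose r hr using hr
  -- An estimate with the wrong syndrome is never correct modulo `B ≤ C`, so replacing it by any
  -- word with the right syndrome does no harm.
  refine ⟨fun x => if D.H.mulVec x = D.H.mulVec (D.estimate (D.H.mulVec x)) then
    D.estimate (D.H.mulVec x) else r (D.H.mulVec x), fun x y h => ?_, fun x => ?_, ?_⟩
  · rw [hH] at h
    simp only [h]
  · rw [hH]
    dsimp only
    split_ifs with h
    · exact h
    · exact (hr _ ⟨x, rfl⟩).symm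
  · intro B hB x hx
    have h := (hH _ _).1 (hB hx)
    dsimp only
    rwa [if_pos h]

/-! ### Concatenated codes: dimension and duality -/

section Concatenation

section Blocks

variable {F K : Type*} [Field F] {n M : ℕ}

/-- The block of `x` with label `α`. -/
def block (ε : Fin M ≃ K × Fin n) (α : K) : (Fin M → F) →ₗ[F] (Fin n → F) :=
  LinearMap.funLeft F F fun i => ε.symm (α, i)

/-- The vector with given blocks. -/
def unblock (ε : Fin M ≃ K × Fin n) : (K → Fin n → F) →ₗ[F] (Fin M → F) where
  toFun u p := u (ε p).1 (ε p).2
  map_add' _ _ := rfl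
  map_smul' _ _ := rfl

theorem block_unblock (ε : Fin M ≃ K × Fin n) (u : K → Fin n → F) (α : K) :
    block ε α (unblock ε u) = u α := by
  funext i
  simp [block, unblock, LinearMap.funLeft_apply]

theorem unblock_block (ε : Fin M ≃ K × Fin n) (x : Fin M → F) :
    unblock ε (fun α => block ε α x) = x := by
  funext p
  simp [block, unblock, LinearMap.funLeft_apply]

theorem dotProduct_eq_sum_block [Fintype K] (ε : Fin M ≃ K × Fin n) (x y : Fin M → F) :
    x ⬝ᵥ y = ∑ α, block ε α x ⬝ᵥ block ε α y := by
  simp only [dotProduct, block, LinearMap.funLeft_apply]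
  rw [← Fintype.sum_prod_type', ← ε.symm.sum_comp]

end Blocks

variable {F K : Type*} [Field F] [Field K] [Fintype K] [Algebra F K] {n M : ℕ}

/-- The syndromes of the outer code. -/
noncomputable def outerSyndrome (ε : Fin M ≃ K × Fin n) (φ : (Fin n → F) →ₗ[F] K) (d : ℕ) :
    (Fin M → F) →ₗ[F] (Fin d → K) :=
  LinearMap.pi fun m => ∑ α, LinearMap.mulLeft F (α ^ (m : ℕ)) ∘ₗ φ ∘ₗ block ε α

theorem outerSyndrome_apply (ε : Fin M ≃ K × Fin n) (φ : (Fin n → F) →ₗ[F] K) (d : ℕ)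
    (x : Fin M → F) (m : Fin d) :
    outerSyndrome ε φ d x m = powerSum (fun α => φ (block ε α x)) m := by
  simp [outerSyndrome, powerSum]

/-- The concatenation of an inner code with an outer Reed–Solomon code. -/
noncomputable def concatCode (ε : Fin M ≃ K × Fin n) (C : Submodule F (Fin n → F))
    (φ : (Fin n → F) →ₗ[F] K) (d : ℕ) : Submodule F (Fin M → F) :=
  (⨅ α, C.comap (block ε α)) ⊓ LinearMap.ker (outerSyndrome ε φ d)

theorem mem_concatCode {ε : Fin M ≃ K × Fin n} {C : Submodule F (Fin n → F)}
    {φ : (Fin n → F) →ₗ[F] K} {d : ℕ} {x : Fin M → F} :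
    x ∈ concatCode ε C φ d ↔ (∀ α, block ε α x ∈ C) ∧
      ∀ m < d, powerSum (fun α => φ (block ε α x)) m = 0 := by
  simp only [concatCode, Submodule.mem_inf, Submodule.mem_iInf, Submodule.mem_comap,
    LinearMap.mem_ker, funext_iff, outerSyndrome_apply, Pi.zero_apply]
  exact and_congr_right fun _ => ⟨fun h m hm => h ⟨m, hm⟩, fun h m => h m m.2⟩

/-- The section `s` and the Vandermonde system make the outer syndrome map onto, so `d` checks over
`K` cost exactly `d * finrank F K` dimensions. -/
theorem finrank_concatCode [Fintype F] (ε : Fin M ≃ K × Fin n) (C : Submodule F (Fin n → F))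
    (φ : (Fin n → F) →ₗ[F] K) {d : ℕ} (hd : d ≤ Fintype.card K) (s : K → Fin n → F)
    (hs : ∀ z, s z ∈ C) (hφs : ∀ z, φ (s z) = z) :
    Module.finrank F (concatCode ε C φ d) + d * Module.finrank F K =
      Fintype.card K * Module.finrank F C := by
  have : Module.Finite F K := .of_finite
  let G : (K → C) →ₗ[F] (Fin M → F) :=
    unblock ε ∘ₗ LinearMap.pi fun α => C.subtype ∘ₗ LinearMap.proj α
  have hG : ∀ u α, block ε α (G u) = u α := fun u α => by
    simp only [G, LinearMap.comp_apply, block_unblock]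
    rfl
  have hinj : Function.Injective G := fun u v h => by
    funext α
    exact Subtype.ext (by rw [← hG u, ← hG v, h])
  let T := outerSyndrome ε φ d ∘ₗ G
  have hmap : (LinearMap.ker T).map G = concatCode ε C φ d := by
    ext x
    constructor
    · rintro ⟨u, hu, rfl⟩
      refine ⟨?_, hu⟩
      simp only [SetLike.mem_coe, Submodule.mem_iInf, Submodule.mem_comap, hG]
      exact fun α => (u α).2
    · rintro ⟨h1, h2⟩
      simp only [SetLike.mem_coe, Submodule.mem_iInf, Submodule.mem_comap] at h1
      have hx : G (fun α => ⟨block ε α x, h1 α⟩) = x := unblock_block ε x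
      refine ⟨fun α => ⟨block ε α x, h1 α⟩, ?_, hx⟩
      simp only [SetLike.mem_coe, LinearMap.mem_ker, T, LinearMap.comp_apply, hx]
      exact h2
  have hsurj : LinearMap.range T = ⊤ := by
    rw [LinearMap.range_eq_top]
    intro z
    obtain ⟨x, hx⟩ := exists_powerSum_eq hd z
    refine ⟨fun α => ⟨s (x α), hs _⟩, ?_⟩
    funext m
    rw [LinearMap.comp_apply, outerSyndrome_apply, ← hx]
    congr 1
    funext α
    rw [hG, hφs]
  have h1 := LinearMap.finrank_range_add_finrank_ker T
  rw [hsurj, finrank_top, Module.finrank_pi_fintype, Module.finrank_pi_fintype, Finset.sum_const,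
    Finset.sum_const, Finset.card_univ, Finset.card_univ, Fintype.card_fin, smul_eq_mul,
    smul_eq_mul] at h1
  rw [← hmap, ← (Submodule.equivMapOfInjective G hinj _).finrank_eq, add_comm]
  exact h1

/-- A word `x` of the dual is tested against two kinds of words of the second code. Words with a
single nonzero block from `C₁^⊥` force the blocks of `x` into `C₁`; words with outer coordinates `z
* α ^ m` force the outer syndromes of `x` to vanish. -/
theorem dual_concatCode_le [Fintype F] {C : CodePair F n} {l : K →ₗ[F] F} (hl : l ≠ 0)
    (ε : Fin M ≃ K × Fin n) (f : Frame C K l) (d : Fin 2 → ℕ) (hd : d 0 + d 1 ≤ Fintype.card K) :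
    dual (concatCode ε (C.code 1) (f.coord 1) (d 1)) ≤
      concatCode ε (C.code 0) (f.coord 0) (d 0) := by
  classical
  intro x hx
  have hdot : ∀ u : K → Fin n → F,
      unblock ε u ∈ concatCode ε (C.code 1) (f.coord 1) (d 1) →
        ∑ α, u α ⬝ᵥ block ε α x = 0 := by
    intro u hu
    have := hx _ hu
    rw [dotProduct_eq_sum_block ε] at this
    simpa [block_unblock] using this
  have hblock : ∀ α, block ε α x ∈ C.code 0 := by
    intro α
    rw [← dual_dual (C.code 0), mem_dual]
    intro y hy
    have hy1 : y ∈ C.code 1 := C.dual_le 1 hy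
    have h0 : f.coord 1 y = 0 := (f.coord_eq_zero 1 y hy1).2 hy
    have := hdot (Pi.single α y) (by
      rw [mem_concatCode]
      simp only [block_unblock]
      constructor
      · intro β
        by_cases h : β = α
        · subst h
          simpa using hy1
        · simp [h]
      · intro m _
        refine Finset.sum_eq_zero fun β _ => ?_
        by_cases h : β = α
        · subst h
          simp [h0]
        · simp [h])
    rw [Finset.sum_eq_single α] at this
    · simpa using this
    · intro β _ hβ
      simp [hβ]
    · simp
  rw [mem_concatCode]
  refine ⟨hblock, fun m hm => ?_⟩
  by_contra hne
  refine hl (LinearMap.ext fun w => ?_)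
  set P := powerSum (fun α => f.coord 0 (block ε α x)) m with hP
  have hz : ∀ z, l (z * P) = 0 := by
    intro z
    -- The test word passes the checks because `m + m' ≤ d 0 + d 1 - 2 < |K| - 1`, and power sums
    -- over `K` with exponent below `|K| - 1` vanish.
    have := hdot (fun α => f.lift 1 (z * α ^ m)) (by
      rw [mem_concatCode]
      simp only [block_unblock, f.coord_lift]
      refine ⟨fun α => f.lift_mem 1 _, fun m' hm' => ?_⟩
      have h1 : ∀ α : K, α ^ m' * (z * α ^ m) = z * α ^ (m + m') := fun α => by ring
      rw [powerSum, Finset.sum_congr rfl fun α _ => h1 α, ← Finset.mul_sum,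
        FiniteField.sum_pow_lt_card_sub_one K (m + m') (by omega), mul_zero])
    rw [← this, hP, powerSum, Finset.mul_sum, map_sum]
    refine Finset.sum_congr rfl fun α _ => ?_
    rw [dotProduct_comm, f.dotProduct_eq _ (hblock α) _ (f.lift_mem 1 _), f.coord_lift]
    congr 1
    ring
  have := hz (w / P)
  rwa [div_mul_cancel₀ _ hne] at this

end Concatenation

theorem SyndromeDecoder.RunsIn.mono {F : Type*} [Field F] {n : ℕ} {C : Submodule F (Fin n → F)}
    {D : SyndromeDecoder C} {s t : ℕ} (h : D.RunsIn s) (hst : s ≤ t) : D.RunsIn t := by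
  obtain ⟨P, hP, hrun⟩ := h
  exact ⟨P, hP.trans hst, hrun⟩

/-! ### Concatenated codes: decoding -/

section Concatenation

variable {F K : Type*} [Field F] [Fintype F] [Field K] [Fintype K] [Algebra F K] {n M : ℕ}

/-- Decoding of a concatenated code: the inner decoder `est` is applied to the blocks, and the
outer decoder to what remains. -/
noncomputable def concatDecode (ε : Fin M ≃ K × Fin n) (est : (Fin n → F) → Fin n → F)
    (φ : (Fin n → F) →ₗ[F] K) (s : K →ₗ[F] (Fin n → F)) (d : ℕ) (x : Fin M → F) : Fin M → F :=
  unblock ε fun α => est (block ε α x) +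
    s (rsDecode d (d / 2) (fun β => φ (block ε β x - est (block ε β x))) α)

-- Inner estimates depend only on cosets of `C`, so `e` and `e'` give the same ones. The coordinates
-- of the residuals of `e` form a word over `K` that is zero on every correctly decoded block, and
-- its first `d` syndromes are known from `e'`. The outer decoder recovers this word, and correcting
-- by its lift leaves residuals in `B`.
open Classical in
omit [Fintype F] in
theorem sub_concatDecode_mem (ε : Fin M ≃ K × Fin n) {C B : Submodule F (Fin n → F)}
    {est : (Fin n → F) → Fin n → F} (hest : ∀ x y, x - y ∈ C → est x = est y)
    (hestC : ∀ x, x - est x ∈ C) (φ : (Fin n → F) →ₗ[F] K) (s : K →ₗ[F] (Fin n → F))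
    (hs : ∀ z, s z ∈ C) (hφs : ∀ z, φ (s z) = z) (hφ : ∀ x ∈ C, φ x = 0 ↔ x ∈ B) (d : ℕ)
    {e e' : Fin M → F} (he : e - e' ∈ concatCode ε C φ d)
    (hbad : (Finset.univ.filter fun α => ¬ block ε α e - est (block ε α e) ∈ B).card ≤ d / 2)
    (α : K) : block ε α (e - concatDecode ε est φ s d e') ∈ B := by
  rw [mem_concatCode] at he
  obtain ⟨he1, he2⟩ := he
  have hest' : ∀ α, est (block ε α e') = est (block ε α e) := fun α =>
    (hest _ _ (by rw [← map_sub]; exact he1 α)).symm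
  have hrs : rsDecode d (d / 2) (fun β => φ (block ε β e' - est (block ε β e'))) =
      fun β => φ (block ε β e - est (block ε β e)) := by
    refine rsDecode_eq (by omega) (fun m hm => ?_) ?_
    · have h1 := he2 m hm
      have h2 : (fun α => φ (block ε α (e - e'))) =
          (fun β => φ (block ε β e - est (block ε β e))) -
            fun β => φ (block ε β e' - est (block ε β e')) := by
        funext β
        simp only [Pi.sub_apply, ← map_sub φ, hest', map_sub (block ε β)]
        congr 1
        abel
      rw [h2, powerSum_sub, sub_eq_zero] at h1
      exact h1.symm
    · refine (Finset.card_le_card fun β hβ => ?_).trans hbad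
      rw [Finset.mem_filter] at hβ ⊢
      exact ⟨Finset.mem_univ _, fun h => hβ.2 ((hφ _ (hestC _)).2 h)⟩
  have h3 : block ε α (e - concatDecode ε est φ s d e') =
      (block ε α e - est (block ε α e)) - s (φ (block ε α e - est (block ε α e))) := by
    rw [map_sub, concatDecode, block_unblock, hrs, hest']
    abel
  rw [h3, ← hφ _ (sub_mem (hestC _) (hs _)), map_sub, hφs, sub_self]

/-- Only the inner estimates and residual coordinates need tables of size `q ^ n`. Operations of `K`
are tables on pairs, of size `|K| ^ 2 ≤ M ^ 2`, so the outer decoder is polynomial in `M`. -/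
theorem cost_concatDecode (ε : Fin M ≃ K × Fin n) (est : (Fin n → F) → Fin n → F)
    (φ : (Fin n → F) →ₗ[F] K) (s : K →ₗ[F] (Fin n → F)) {d : ℕ} (hd : d ≤ Fintype.card K)
    (hn : Module.finrank F K ≤ n) :
    Cost (inputs F M) (6800 * M ^ 7 * Fintype.card F ^ n)
      (Set.range fun p x => concatDecode ε est φ s d x p) := by
  have : Module.Finite F K := .of_finite
  have hk : 0 < Module.finrank F K := Module.finrank_pos
  set k := Module.finrank F K with hk_def
  have : Nonempty (Fin k) := ⟨⟨0, hk⟩⟩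
  let κ : K ≃ₗ[F] (Fin k → F) := (Module.finBasis F K).equivFun
  have hKcard : Fintype.card F ^ k = Fintype.card K := by
    rw [Fintype.card_congr κ.toEquiv, Fintype.card_fun, Fintype.card_fin]
  have hM : M = Fintype.card K * n := by
    have := Fintype.card_congr ε
    rwa [Fintype.card_prod, Fintype.card_fin, Fintype.card_fin] at this
  have hA := inputs_nonempty F M
  have hin : ∀ α i, (fun x : Fin M → F => block ε α x i) ∈ inputs F M :=
    fun α i => .inr ⟨ε.symm (α, i), rfl⟩
  have h1 : Cost (inputs F M) (Fintype.card (K × Fin n) * (6 * Fintype.card F ^ n))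
      (Set.range fun (p : K × Fin n) x => est (block ε p.1 x) p.2) := by
    refine Cost.range _ fun p => ?_
    have := Cost.lookup hA (fun v => est v p.2) (fun i x => block ε p.1 x i) (hin p.1)
    rwa [Fintype.card_fin] at this
  set v : (Fin M → F) → K → K := fun x β => φ (block ε β x - est (block ε β x)) with hv
  have h2 : Cost (inputs F M) (Fintype.card (K × Fin k) * (6 * Fintype.card F ^ n))
      (Set.range fun (p : K × Fin k) x => κ (v x p.1) p.2) := by
    refine Cost.range _ fun p => ?_
    have := Cost.lookup hA (fun u => κ (φ (u - est u)) p.2) (fun i x => block ε p.1 x i) (hin p.1)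
    rwa [Fintype.card_fin] at this
  have h3 := (Cost.rsDecode (A := Set.range fun α x => v x α) (t := d / 2) (by omega) hd v
    fun α => ⟨α, rfl⟩).expand κ.toEquiv
  set A₁ := inputs F M ∪ ((Set.range fun (p : K × Fin n) x => est (block ε p.1 x) p.2) ∪
    Set.range fun (p : K × Fin k) x => κ (v x p.1) p.2) with hA₁
  have h4 := h3.weaken (A' := A₁) (by
    rintro _ ⟨_, ⟨α, rfl⟩, i, rfl⟩
    exact .inr (.inr ⟨(α, i), rfl⟩))
  set A₂ := A₁ ∪ expand κ.toEquiv (Set.range fun α x => rsDecode d (d / 2) (v x) α) with hA₂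
  have hA₂n : A₂.Nonempty := (hA.mono Set.subset_union_left).mono Set.subset_union_left
  have h5 : Cost A₂ (Fintype.card (Fin M) * (0 + 6 * Fintype.card F ^ k + 1))
      (Set.range fun p x => concatDecode ε est φ s d x p) := by
    refine Cost.range _ fun p => ?_
    have := Cost.lookup hA₂n (fun u => s (κ.symm u) (ε p).2)
      (fun i x => κ (rsDecode d (d / 2) (v x) (ε p).1) i)
      fun i => .inr ⟨_, ⟨(ε p).1, rfl⟩, i, rfl⟩
    rw [Fintype.card_fin] at this
    have h6 : (fun x => est (block ε (ε p).1 x) (ε p).2) ∈ A₂ := .inl (.inr (.inl ⟨ε p, rfl⟩))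
    have := Cost.op (· + ·) (.mem h6) this
    simp only [LinearEquiv.symm_apply_apply] at this
    exact this
  refine ((h1.union h2).trans (h4.trans h5)).le ?_
  simp only [Fintype.card_prod, Fintype.card_fin, mul_comm 2, pow_mul, hKcard]
  have hN : 1 ≤ Fintype.card K := Fintype.card_pos
  have hn1 : 1 ≤ n := hk.trans_le hn
  have hNM : Fintype.card K ≤ M := by rw [hM]; exact Nat.le_mul_of_pos_right _ hn1
  have hnM : n ≤ M := by rw [hM]; exact Nat.le_mul_of_pos_left _ hN
  have hkM : k ≤ M := hn.trans hnM
  have hM1 : 1 ≤ M := hn1.trans hnM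
  have hQ : 1 ≤ Fintype.card F ^ n := Nat.one_le_pow _ _ Fintype.card_pos
  set Q := Fintype.card F ^ n
  set N := Fintype.card K
  have e2 : M ^ 2 ≤ M ^ 7 := Nat.pow_le_pow_right hM1 (by norm_num)
  have e1 : M ≤ M ^ 7 := Nat.le_self_pow (by norm_num) M
  calc _ ≤ M * M * (6 * Q) + M * M * (6 * Q) + (70 * (M + M) ^ 4 * (M * (6 * M ^ 2)) +
        M * (0 + 6 * M + 1)) := by gcongr
    _ = 12 * M ^ 2 * Q + (6720 * M ^ 7 + 6 * M ^ 2 + M) * 1 := by ring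
    _ ≤ 12 * M ^ 7 * Q + (6720 * M ^ 7 + 6 * M ^ 7 + M ^ 7) * Q := by gcongr
    _ ≤ 6800 * M ^ 7 * Q := by
      rw [← add_mul]
      gcongr
      omega

omit [Field K] [Algebra F K] in
theorem sum_blocks [DecidableEq K] (ε : Fin M ≃ K × Fin n) (W : PMF F) (P : (K → Fin n → F) → Prop)
    [DecidablePred P] :
    (∑ e : Fin M → F, if P (fun α => block ε α e) then ∏ i, W (e i) else 0) =
      ∑ u : K → Fin n → F, if P u then ∏ α, ∏ i, W (u α i) else 0 := by
  classical
  let E : (Fin M → F) ≃ (K → Fin n → F) :=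
    ⟨fun x α => block ε α x, unblock ε, unblock_block ε, fun u => funext (block_unblock ε u)⟩
  rw [← E.sum_comp]
  refine Finset.sum_congr rfl fun e _ => ?_
  have h : ∏ i, W (e i) = ∏ α, ∏ i, W (E e α i) := by
    rw [← Fintype.prod_prod_type', ← ε.symm.prod_comp]
    rfl
  rw [h]
  rfl

-- Decoding can fail only when more than `d / 2` blocks are decoded wrongly. The blocks carry
-- independent errors, so `sum_prod_le_of_many` applies.
open Classical in
theorem exists_concatDecoder (ε : Fin M ≃ K × Fin n) {C B : Submodule F (Fin n → F)} (hBC : B ≤ C)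
    (D : SyndromeDecoder C) (φ : (Fin n → F) →ₗ[F] K) (s : K →ₗ[F] (Fin n → F))
    (hs : ∀ z, s z ∈ C) (hφs : ∀ z, φ (s z) = z) (hφ : ∀ x ∈ C, φ x = 0 ↔ x ∈ B) {d : ℕ}
    (hd : d ≤ Fintype.card K) (hn : Module.finrank F K ≤ n) :
    ∃ D' : SyndromeDecoder (concatCode ε C φ d), D'.RunsIn (7000 * M ^ 7 * Fintype.card F ^ n) ∧
      ∀ (W : PMF F) (B' : Submodule F (Fin M → F)), (∀ x, (∀ α, block ε α x ∈ B) → x ∈ B') →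
        D'.errorProb B' W ≤ 2 ^ Fintype.card K * (D.errorProb B W) ^ (d / 2 + 1) := by
  obtain ⟨est, hest, hestC, hestB⟩ := D.exists_consistent
  obtain ⟨D', hrun, hD'⟩ := exists_syndromeDecoder (concatCode ε C φ d)
    (concatDecode ε est φ s d) (cost_concatDecode ε est φ s hd hn)
  refine ⟨D', hrun.mono ?_, fun W B' hB' => ?_⟩
  · have : Module.Finite F K := .of_finite
    have hk : 0 < Module.finrank F K := Module.finrank_pos
    have hM : M = Fintype.card K * n := by
      have := Fintype.card_congr ε
      rwa [Fintype.card_prod, Fintype.card_fin, Fintype.card_fin] at this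
    have hM1 : 1 ≤ M := by
      rw [hM]
      exact Nat.mul_pos Fintype.card_pos (hk.trans_le hn)
    have hQ : 1 ≤ Fintype.card F ^ n := Nat.one_le_pow _ _ Fintype.card_pos
    calc 4 * (M + 1) ^ 2 + 6800 * M ^ 7 * Fintype.card F ^ n
        ≤ 4 * (M + M) ^ 2 * 1 + 6800 * M ^ 7 * Fintype.card F ^ n := by
          rw [mul_one]
          gcongr
      _ ≤ 4 * (M + M) ^ 2 * Fintype.card F ^ n + 6800 * M ^ 7 * Fintype.card F ^ n := by gcongr
      _ ≤ 7000 * M ^ 7 * Fintype.card F ^ n := by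
          rw [← add_mul]
          gcongr
          have : M ^ 2 ≤ M ^ 7 := Nat.pow_le_pow_right hM1 (by norm_num)
          nlinarith
  · set bad : (Fin n → F) → Prop := fun y => ¬ y - est y ∈ B with hbad
    calc D'.errorProb B' W
        ≤ ∑ e : Fin M → F, if d / 2 < (Finset.univ.filter fun α => bad (block ε α e)).card then
            ∏ i, W (e i) else 0 := by
          refine Finset.sum_le_sum fun e _ => ?_
          obtain ⟨e', he, hD⟩ := hD' e
          by_cases h : d / 2 < (Finset.univ.filter fun α => bad (block ε α e)).card
          · rw [if_pos h]
            split_ifs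
            · exact zero_le
            · exact le_rfl
          · rw [if_pos]
            · exact zero_le
            · rw [hD]
              exact hB' _ (sub_concatDecode_mem ε hest hestC φ s hs hφs hφ d he (not_lt.1 h))
      _ = ∑ u : K → Fin n → F, if d / 2 < (Finset.univ.filter fun α => bad (u α)).card then
            ∏ α, ∏ i, W (u α i) else 0 :=
          sum_blocks ε W fun u => d / 2 < (Finset.univ.filter fun α => bad (u α)).card
      _ ≤ _ := sum_prod_le_of_many (fun y => ∏ i, W (y i)) (sum_prod_pmf W n) bad (d / 2)
      _ ≤ _ := by
          gcongr
          refine Finset.sum_le_sum fun y _ => ?_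
          by_cases h : y - D.estimate (D.H.mulVec y) ∈ B
          · have := hestB B hBC y h
            simp [hbad, this]
          · rw [if_neg h]
            split_ifs
            · exact le_rfl
            · exact zero_le

end Concatenation

/-! ### The concatenation theorem for code pairs -/

/-- Concatenation of a code pair with Reed–Solomon codes over the extension of degree `k`. -/
theorem exists_concatenation {F : Type*} [Field F] [Fintype F] {n k : ℕ} (C : CodePair F n)
    (D : C.Decoders) (hk0 : 0 < k)
    (hk : Module.finrank F (C.code 0) + Module.finrank F (C.code 1) = n + k)
    (d : Fin 2 → ℕ) (hd : d 0 + d 1 ≤ Fintype.card F ^ k) :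
    ∃ (L : CodePair F (Fintype.card F ^ k * n)) (D' : L.Decoders),
      L.rate = (k : ℝ) / n * (1 - ((d 0 : ℝ) + d 1) / (Fintype.card F : ℝ) ^ k) ∧
      (∀ W j, D'.errorProb W j ≤
        2 ^ (Fintype.card F ^ k) * (D.errorProb W j) ^ (d j / 2 + 1)) ∧
      ∀ j, (D' j).RunsIn (7000 * (Fintype.card F ^ k * n) ^ 7 * Fintype.card F ^ n) := by
  classical
  obtain ⟨p, hp⟩ := CharP.exists F
  have : Fact p.Prime := ⟨CharP.char_is_prime F p⟩
  have : NeZero k := ⟨hk0.ne'⟩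
  let K := FiniteField.Extension F p k
  let : Fintype K := Fintype.ofFinite K
  have hKk : Module.finrank F K = k := FiniteField.finrank_extension F p k
  have hKcard : Fintype.card K = Fintype.card F ^ k := by
    rw [← Nat.card_eq_fintype_card, ← Nat.card_eq_fintype_card]
    exact FiniteField.natCard_extension F p k
  obtain ⟨l, hl⟩ : ∃ l : K →ₗ[F] F, l ≠ 0 := by
    have : Nontrivial (Module.Dual F K) :=
      Module.nontrivial_of_finrank_pos (R := F) (by rw [Subspace.dual_finrank_eq, hKk]; exact hk0)
    exact exists_ne 0
  obtain ⟨f⟩ := exists_frame C K hl (by rw [hk, hKk])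
  have hn : k ≤ n := by
    have h0 := Submodule.finrank_le (C.code 0)
    have h1 := Submodule.finrank_le (C.code 1)
    rw [Module.finrank_fin_fun] at h0 h1
    omega
  have hdj : ∀ j, d j ≤ Fintype.card K := by
    simp only [Fin.forall_fin_two]
    omega
  let ε : Fin (Fintype.card F ^ k * n) ≃ K × Fin n :=
    Fintype.equivOfCardEq (by rw [Fintype.card_prod, hKcard, Fintype.card_fin, Fintype.card_fin])
  let L : CodePair F (Fintype.card F ^ k * n) :=
    ⟨fun j => concatCode ε (C.code j) (f.coord j) (d j),
      dual_concatCode_le hl ε f d (by rw [hKcard]; exact hd)⟩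
  choose D' hrun herr using fun j => exists_concatDecoder ε (C.dual_le j) (D j) (f.coord j)
    (f.lift j) (f.lift_mem j) (f.coord_lift j) (f.coord_eq_zero j) (hdj j) (by rw [hKk]; exact hn)
  refine ⟨L, D', ?_, fun W j => ?_, fun j => hrun j⟩
  · have h := fun j => finrank_concatCode ε (C.code j) (f.coord j) (hdj j) (f.lift j) (f.lift_mem j)
      (f.coord_lift j)
    simp only [hKk, hKcard] at h
    have h0 : (Module.finrank F (L.code 0) : ℝ) + d 0 * k =
        (Fintype.card F : ℝ) ^ k * Module.finrank F (C.code 0) := by exact_mod_cast h 0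
    have h1 : (Module.finrank F (L.code 1) : ℝ) + d 1 * k =
        (Fintype.card F : ℝ) ^ k * Module.finrank F (C.code 1) := by exact_mod_cast h 1
    have h2 : (Module.finrank F (C.code 0) : ℝ) + Module.finrank F (C.code 1) = n + k := by
      exact_mod_cast hk
    have hn0 : (n : ℝ) ≠ 0 := by
      have : 0 < n := hk0.trans_le hn
      positivity
    have hq0 : (Fintype.card F : ℝ) ^ k ≠ 0 := by
      have : 0 < Fintype.card F := Fintype.card_pos
      positivity
    rw [CodePair.rate]
    push_cast
    rw [eq_sub_of_add_eq h0, eq_sub_of_add_eq h1, eq_sub_of_add_eq h2]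
    field_simp
    ring
  · have := herr j (W j) (dual (L.code j.rev)) fun x hx y hy => by
      rw [dotProduct_eq_sum_block ε]
      exact Finset.sum_eq_zero fun α _ => hx α _ ((mem_concatCode.1 hy).1 α)
    rwa [hKcard] at this

/-! ### Good code pairs by averaging -/

open Classical in
/-- The decoder which looks for an error pattern in a set `T` of likely ones. -/
theorem exists_decoder_of_set {F : Type*} [Field F] [Fintype F] {n : ℕ}
    (C : Submodule F (Fin n → F)) (T : Finset (Fin n → F)) :
    ∃ D : SyndromeDecoder C, ∀ (W : PMF F) (B : Submodule F (Fin n → F)), D.errorProb B W ≤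
      (∑ e : Fin n → F, if e ∈ T then 0 else ∏ i, W (e i)) +
        ∑ e : Fin n → F, (∏ i, W (e i)) * (T.filter fun x => x ≠ e ∧ x - e ∈ C).card := by
  obtain ⟨m, H, -, hH, hC⟩ := exists_parityCheck C
  have hr : ∀ s : Fin m → F, ∃ y, (∃ x ∈ T, H.mulVec x = s) → y ∈ T ∧ H.mulVec y = s := fun s => by
    by_cases h : ∃ x ∈ T, H.mulVec x = s
    · exact ⟨h.choose, fun _ => h.choose_spec⟩
    · exact ⟨0, fun h' => absurd h' h⟩
  choose r hr using hr
  refine ⟨⟨m, H, hH, hC, r⟩, fun W B => ?_⟩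
  rw [← Finset.sum_add_distrib]
  refine Finset.sum_le_sum fun e _ => ?_
  dsimp only
  split_ifs with h1 h2 h2
  · exact zero_le
  · exact zero_le
  · rw [zero_add]
    obtain ⟨h3, h4⟩ := hr (H.mulVec e) ⟨e, h2, rfl⟩
    have h5 : 1 ≤ (T.filter fun x => x ≠ e ∧ x - e ∈ C).card := by
      refine Finset.card_pos.2 ⟨r (H.mulVec e), Finset.mem_filter.2 ⟨h3, fun h => h1 ?_, ?_⟩⟩
      · rw [h, sub_self]
        exact zero_mem B
      · rw [hC, Matrix.mulVec_sub, h4, sub_self]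
    calc ∏ i, W (e i) = (∏ i, W (e i)) * 1 := (mul_one _).symm
      _ ≤ _ := by gcongr; exact_mod_cast h5
  · exact le_self_add

section Ensemble

theorem exists_submodule_le_submodule (F : Type*) {V : Type*} [Field F] [AddCommGroup V]
    [Module F V] [FiniteDimensional F V] {a b : ℕ} (hab : a ≤ b) (hb : b ≤ Module.finrank F V) :
    ∃ A B : Submodule F V, A ≤ B ∧ Module.finrank F A = a ∧ Module.finrank F B = b := by
  let v := Module.finBasis F V
  have hr : ∀ m (hm : m ≤ Module.finrank F V),
      Module.finrank F (Submodule.span F (Set.range fun i : Fin m => v (Fin.castLE hm i))) = m := by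
    intro m hm
    have := finrank_span_eq_card (v.linearIndependent.comp _ (Fin.castLE_injective hm))
    rwa [Fintype.card_fin] at this
  refine ⟨_, _, Submodule.span_mono ?_, hr a (hab.trans hb), hr b hb⟩
  rintro _ ⟨i, rfl⟩
  exact ⟨Fin.castLE hab i, rfl⟩

/-- A family of code pairs, labelled by the nonzero elements of the field with `q ^ n` elements,
in which each nonzero word belongs to few of the codes. -/
theorem exists_balanced_family {F : Type*} [Field F] [Fintype F] {n : ℕ} (hn : 0 < n)
    (k : Fin 2 → ℕ) (hk : ∀ j, k j ≤ n) (hkn : n ≤ k 0 + k 1) :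
    ∃ (ι : Type) (_ : Fintype ι) (C : ι → CodePair F n), Fintype.card ι + 1 = Fintype.card F ^ n ∧
      (∀ a j, Module.finrank F ((C a).code j) = k j) ∧
      ∀ (s : Finset ι) (j : Fin 2) (x : Fin n → F), x ≠ 0 → (∀ a ∈ s, x ∈ (C a).code j) →
        s.card ≤ Fintype.card F ^ k j := by
  classical
  obtain ⟨p, hp⟩ := CharP.exists F
  have : Fact p.Prime := ⟨CharP.char_is_prime F p⟩
  have : NeZero n := ⟨hn.ne'⟩
  let K := FiniteField.Extension F p n
  let : Fintype K := Fintype.ofFinite K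
  have hKn : Module.finrank F K = n := FiniteField.finrank_extension F p n
  have hKcard : Fintype.card K = Fintype.card F ^ n := by
    rw [Module.card_eq_pow_finrank (K := F) (V := K), hKn]
  obtain ⟨l, hl⟩ : ∃ l : K →ₗ[F] F, l ≠ 0 := by
    have : Nontrivial (Module.Dual F K) :=
      Module.nontrivial_of_finrank_pos (R := F) (by rw [Subspace.dual_finrank_eq, hKn]; exact hn)
    exact exists_ne 0
  obtain ⟨θ, hθ⟩ := exists_equiv_dual (F := F) (K := K) hl
  obtain ⟨ψ⟩ : Nonempty (K ≃ₗ[F] (Fin n → F)) :=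
    FiniteDimensional.nonempty_linearEquiv_of_finrank_eq (by rw [hKn, Module.finrank_fin_fun])
  -- The family consists of the multiplicative translates of one flag `U ≤ V`: the first code is `a
  -- V`, the second the dual of `a U`.
  obtain ⟨U, V, hUV, hU, hV⟩ := exists_submodule_le_submodule F (V := K) (a := n - k 1) (b := k 0)
    (by omega) (by rw [hKn]; exact hk 0)
  let f : Kˣ → K →ₗ[F] (Fin n → F) := fun a => ψ.toLinearMap ∘ₗ LinearMap.mulLeft F (a : K)
  have hf : ∀ a z, f a z = ψ (a * z) := fun a z => rfl
  have hfinj : ∀ a, Function.Injective (f a) := fun a z w h => by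
    rw [hf, hf, ψ.injective.eq_iff] at h
    exact a.isUnit.mul_left_cancel h
  have hfin : ∀ a (A : Submodule F K), Module.finrank F (A.map (f a)) = Module.finrank F A :=
    fun a A => (Submodule.equivMapOfInjective (f a) (hfinj a) A).finrank_eq.symm
  let C : Kˣ → CodePair F n := fun a => ⟨![V.map (f a), dual (U.map (f a))], by
    simpa [dual_dual] using Submodule.map_mono hUV⟩
  -- The annihilator of `U` for the form `l (u * z)`. It reduces membership in the second code to `a
  -- * Y ∈ U'`, where `Y` represents the functional `z ↦ ψ z ⬝ᵥ x`; at most `|U'| = q ^ k 1` units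
  -- `a` qualify.
  let U' : Submodule F K := U.dualAnnihilator.map θ.symm.toLinearMap
  have hU' : ∀ z, z ∈ U' ↔ ∀ u ∈ U, l (u * z) = 0 := by
    intro z
    simp only [U', Submodule.mem_map_equiv, LinearEquiv.symm_symm, Submodule.mem_dualAnnihilator, hθ]
  have hUk : Module.finrank F U' = k 1 := by
    have h1 := Subspace.finrank_add_finrank_dualAnnihilator_eq U
    have h2 : Module.finrank F U' = Module.finrank F U.dualAnnihilator :=
      LinearEquiv.finrank_map_eq θ.symm _
    have := hk 1
    omega
  have hcard : ∀ (A : Submodule F K) (s : Finset Kˣ) (g : Kˣ → K), Function.Injective g →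
      (∀ a ∈ s, g a ∈ A) → s.card ≤ Fintype.card F ^ Module.finrank F A := by
    intro A s g hg hgA
    rw [← Module.card_eq_pow_finrank (K := F) (V := A), Fintype.card_subtype]
    exact Finset.card_le_card_of_injOn g (fun a ha => by simpa using hgA a ha) hg.injOn
  refine ⟨Kˣ, inferInstance, C, ?_, ?_, ?_⟩
  · rw [← hKcard, Fintype.card_units]
    have : 0 < Fintype.card K := Fintype.card_pos
    omega
  · intro a
    rw [Fin.forall_fin_two]
    refine ⟨(hfin a V).trans hV, ?_⟩
    have h1 := finrank_dual_add (U.map (f a))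
    rw [hfin, hU] at h1
    have h2 : Module.finrank F ((C a).code 1) = Module.finrank F (dual (U.map (f a))) := rfl
    have := hk 1
    omega
  · intro s j x hx hs
    fin_cases j
    · have hx' : ψ.symm x ≠ 0 := by simpa using hx
      have := hcard V s (fun a => (a⁻¹ : Kˣ) * ψ.symm x) (fun a b h =>
          inv_injective (Units.ext (mul_right_cancel₀ hx' h))) fun a ha => by
        obtain ⟨z, hz, hzx⟩ := hs a ha
        rw [← hzx, hf, LinearEquiv.symm_apply_apply]
        simpa using hz
      rwa [hV] at this
    · let T : (Fin n → F) →ₗ[F] Module.Dual F K := (dotProductBilin F F).flip.compl₂ ψ.toLinearMap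
      have hT : ∀ y z, T y z = ψ z ⬝ᵥ y := fun y z => by simp [T]
      set Y := θ.symm (T x) with hY
      have hlY : ∀ z, l (z * Y) = ψ z ⬝ᵥ x := fun z => by
        rw [← hθ, hY, LinearEquiv.apply_symm_apply, hT]
      have hY0 : Y ≠ 0 := by
        intro h
        refine hx (dotProduct_eq_zero_iff.1 fun w => ?_)
        have := hlY (ψ.symm w)
        rw [h, mul_zero, map_zero, LinearEquiv.apply_symm_apply] at this
        rw [dotProduct_comm, ← this]
      have := hcard U' s (fun a => (a : K) * Y) (fun a b h => by
          exact Units.ext (mul_right_cancel₀ hY0 h)) fun a ha => by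
        rw [hU']
        intro u hu
        have h1 : x ∈ dual (U.map (f a)) := hs a ha
        have h2 := h1 _ ⟨u, hu, rfl⟩
        rw [hf, ← hlY] at h2
        rw [← h2]
        congr 1
        ring
      rwa [hUk] at this

open Classical in
/-- The average over the balanced family. -/
theorem exists_codePair_of_sets {F : Type*} [Field F] [Fintype F] (W : Fin 2 → PMF F) {n : ℕ}
    (hn : 0 < n) (k : Fin 2 → ℕ) (hk : ∀ j, k j ≤ n) (hkn : n ≤ k 0 + k 1)
    (T : Fin 2 → Finset (Fin n → F)) :
    ∃ (C : CodePair F n) (D : C.Decoders), (∀ j, Module.finrank F (C.code j) = k j) ∧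
      ∀ j, D.errorProb W j ≤ ∑ i, ((∑ e : Fin n → F, if e ∈ T i then 0 else ∏ l, W i (e l)) +
        2 * ((T i).card * (Fintype.card F : ℝ≥0∞) ^ k i / (Fintype.card F : ℝ≥0∞) ^ n)) := by
  obtain ⟨ι, _, C, hι, hfin, hbal⟩ := exists_balanced_family (F := F) hn k hk hkn
  choose D hD using fun a j => exists_decoder_of_set ((C a).code j) (T j)
  set Q : ℝ≥0∞ := (Fintype.card F : ℝ≥0∞) with hQ
  set P : Fin 2 → ℝ≥0∞ := fun i => ∑ e : Fin n → F, if e ∈ T i then 0 else ∏ l, W i (e l) with hP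
  have hq : 2 ≤ Fintype.card F := Fintype.one_lt_card
  have hqn : 2 ≤ Fintype.card F ^ n := hq.trans (Nat.le_self_pow hn.ne' _)
  have : Nonempty ι := Fintype.card_pos_iff.1 (by omega)
  set A : ℝ≥0∞ := (Fintype.card ι : ℝ≥0∞) with hA
  have hA0 : A ≠ 0 := by
    rw [hA]
    exact_mod_cast Fintype.card_ne_zero
  have hAt : A ≠ ⊤ := ENNReal.natCast_ne_top _
  -- The family has `q ^ n - 1` members, at least half of `q ^ n`; this is the factor `2` in the
  -- bound.
  have hAQ : Q ^ n ≤ 2 * A := by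
    rw [hQ, hA]
    exact_mod_cast (by omega : Fintype.card F ^ n ≤ 2 * Fintype.card ι)
  have hsum : ∀ j, ∑ a, (D a j).errorProb (dual ((C a).code j.rev)) (W j) ≤
      A * P j + (T j).card * Q ^ k j := by
    intro j
    calc _ ≤ ∑ a, (P j + ∑ e : Fin n → F, (∏ i, W j (e i)) *
          ((T j).filter fun x => x ≠ e ∧ x - e ∈ (C a).code j).card) :=
          Finset.sum_le_sum fun a _ => hD a j _ _
      _ = A * P j + ∑ e : Fin n → F, (∏ i, W j (e i)) *
          ∑ a, (((T j).filter fun x => x ≠ e ∧ x - e ∈ (C a).code j).card : ℝ≥0∞) := by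
          rw [Finset.sum_add_distrib, Finset.sum_const, Finset.card_univ, nsmul_eq_mul,
            Finset.sum_comm]
          simp_rw [Finset.mul_sum]
          rfl
      _ ≤ A * P j + ∑ e : Fin n → F, (∏ i, W j (e i)) * ((T j).card * Q ^ k j) := by
          gcongr with e _
          have h1 : ∑ a, ((T j).filter fun x => x ≠ e ∧ x - e ∈ (C a).code j).card ≤
              (T j).card * Fintype.card F ^ k j := by
            simp_rw [Finset.card_filter]
            rw [Finset.sum_comm, ← smul_eq_mul]
            refine Finset.sum_le_card_nsmul _ _ _ fun x _ => ?_
            rw [← Finset.card_filter]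
            by_cases hx : x = e
            · simp [hx]
            · exact hbal _ j (x - e) (sub_ne_zero.2 hx) fun a ha => (Finset.mem_filter.1 ha).2.2
          rw [hQ]
          exact_mod_cast h1
      _ = _ := by rw [← Finset.sum_mul, sum_prod_pmf, one_mul]
  -- One index must serve both channels, so the sum of the two error probabilities is minimized.
  obtain ⟨a, -, ha⟩ := Finset.exists_min_image Finset.univ
    (fun a => ∑ j, (D a j).errorProb (dual ((C a).code j.rev)) (W j)) Finset.univ_nonempty
  refine ⟨C a, D a, hfin a, fun j => ?_⟩
  have h1 : A * ∑ j, (D a j).errorProb (dual ((C a).code j.rev)) (W j) ≤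
      ∑ j, (A * P j + (T j).card * Q ^ k j) := by
    rw [hA, ← nsmul_eq_mul, ← Finset.card_univ]
    refine (Finset.card_nsmul_le_sum _ _ _ ha).trans ?_
    rw [Finset.sum_comm]
    exact Finset.sum_le_sum fun j _ => hsum j
  calc (D a j).errorProb (dual ((C a).code j.rev)) (W j)
      ≤ ∑ j, (D a j).errorProb (dual ((C a).code j.rev)) (W j) :=
        Finset.single_le_sum (f := fun j => (D a j).errorProb (dual ((C a).code j.rev)) (W j))
          (fun _ _ => zero_le) (Finset.mem_univ j)
    _ ≤ (∑ j, (A * P j + (T j).card * Q ^ k j)) / A := by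
        rw [ENNReal.le_div_iff_mul_le (.inl hA0) (.inl hAt), mul_comm]
        exact h1
    _ = ∑ j, (P j + (T j).card * Q ^ k j / A) := by
        rw [ENNReal.div_eq_inv_mul, Finset.mul_sum]
        refine Finset.sum_congr rfl fun j _ => ?_
        rw [mul_add, ← mul_assoc, ENNReal.inv_mul_cancel hA0 hAt, one_mul, ← ENNReal.div_eq_inv_mul]
    _ ≤ _ := by
        gcongr with i _
        rw [← ENNReal.mul_div_mul_left _ _ two_ne_zero ENNReal.ofNat_ne_top, mul_div_assoc]
        gcongr

end Ensemble

/-! ### Typical sets and random-coding exponents -/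

section Typical

variable {F : Type*} [Fintype F]

theorem sum_toReal_pmf (W : PMF F) : ∑ a, (W a).toReal = 1 := by
  have h : ∑ a, W a = 1 := by rw [← W.tsum_coe, tsum_fintype]
  rw [← ENNReal.toReal_sum fun a _ => W.apply_ne_top a, h, ENNReal.toReal_one]

theorem entropy_nonneg (W : PMF F) : 0 ≤ entropy W := by
  refine Finset.sum_nonneg fun a _ => div_nonneg ?_ (Real.log_natCast_nonneg _)
  refine Real.negMulLog_nonneg ENNReal.toReal_nonneg ?_
  have := ENNReal.toReal_mono ENNReal.one_ne_top (W.coe_le_one a)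
  rwa [ENNReal.toReal_one] at this

theorem exists_lt_of_hasDerivAt_neg {g : ℝ → ℝ} {g' : ℝ} (hg : HasDerivAt g g' 0) (h : g' < 0) :
    ∃ s > 0, g s < g 0 := by
  have h1 := (hasDerivAt_iff_tendsto_slope.1 hg).eventually (gt_mem_nhds h)
  have h2 : ∀ᶠ s in 𝓝[>] (0 : ℝ), slope g 0 s < 0 :=
    h1.filter_mono (nhdsWithin_mono _ fun s (hs : 0 < s) => hs.ne')
  obtain ⟨s, hs, hs0⟩ := (h2.and self_mem_nhdsWithin).exists
  have hs0 : 0 < s := hs0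
  refine ⟨s, hs0, ?_⟩
  rw [slope_def_field, sub_zero, div_lt_iff₀ hs0, zero_mul] at hs
  linarith

/-- Chernoff bound: a set of at most `q ^ (n (H + η))` words carries all but an exponentially small
part of the probability. -/
theorem exists_typical_sets (hF : 1 < Fintype.card F) (W : PMF F) {η : ℝ} (hη : 0 < η) :
    ∃ ρ : ℝ, 0 ≤ ρ ∧ ρ < 1 ∧ ∀ n : ℕ, ∃ T : Finset (Fin n → F),
      (T.card : ℝ) ≤ (Fintype.card F : ℝ) ^ ((n : ℝ) * (entropy W + η)) ∧
      ∀ [DecidablePred (· ∈ T)],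
      (∑ e : Fin n → F, if e ∈ T then 0 else ∏ i, W (e i)) ≤ ENNReal.ofReal (ρ ^ n) := by
  classical
  set w : F → ℝ := fun a => (W a).toReal with hw
  have hw0 : ∀ a, 0 ≤ w a := fun a => ENNReal.toReal_nonneg
  set L := Real.log (Fintype.card F) with hL
  have hL0 : 0 < L := Real.log_pos (by exact_mod_cast hF)
  set c := (entropy W + η) * L with hc
  have hHL : entropy W * L = ∑ a, Real.negMulLog (w a) := by
    rw [entropy, Finset.sum_mul]
    exact Finset.sum_congr rfl fun a _ => div_mul_cancel₀ _ hL0.ne'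
  -- The moment generating function of `-log w - c`, whose mean is `-η * log q < 0`; so it drops
  -- below `1` for some `s > 0`. Letters of probability zero contribute nothing.
  set g : ℝ → ℝ := fun s => ∑ a, w a * Real.exp (s * (-Real.log (w a) - c)) with hg
  have hg0 : g 0 = 1 := by simp [hg, hw, sum_toReal_pmf]
  have hd : HasDerivAt g (∑ a, w a * (-Real.log (w a) - c)) 0 := by
    refine HasDerivAt.fun_sum fun a _ => HasDerivAt.const_mul _ ?_
    have := ((hasDerivAt_id (0 : ℝ)).mul_const (-Real.log (w a) - c)).exp
    simpa using this
  have hneg : ∑ a, w a * (-Real.log (w a) - c) < 0 := by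
    have : ∑ a, w a * (-Real.log (w a) - c) = entropy W * L - c := by
      rw [hHL]
      simp only [mul_sub, Finset.sum_sub_distrib, ← Finset.sum_mul]
      rw [show ∑ a, w a = 1 from sum_toReal_pmf W, one_mul]
      congr 1
      exact Finset.sum_congr rfl fun a _ => by rw [Real.negMulLog]; ring
    rw [this, hc]
    nlinarith
  obtain ⟨s, hs, hgs⟩ := exists_lt_of_hasDerivAt_neg hd hneg
  rw [hg0] at hgs
  have hgs0 : 0 ≤ g s := Finset.sum_nonneg fun a _ => mul_nonneg (hw0 a) (Real.exp_pos _).le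
  refine ⟨g s, hgs0, hgs, fun n => ?_⟩
  -- The words of probability at least `q ^ (-n (H + η))`. As the probabilities sum to `1`, there
  -- are at most `q ^ (n (H + η))` of them.
  refine ⟨Finset.univ.filter fun x => Real.exp (-(n * c)) ≤ ∏ i, w (x i), ?_, ?_⟩
  · have h1 : ∀ x ∈ Finset.univ.filter (fun x : Fin n → F => Real.exp (-(n * c)) ≤ ∏ i, w (x i)),
        Real.exp (-(n * c)) ≤ ∏ i, w (x i) := fun x hx => (Finset.mem_filter.1 hx).2
    have h2 := Finset.card_nsmul_le_sum _ _ _ h1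
    have h3 : ∑ x : Fin n → F, ∏ i, w (x i) = 1 := by
      have h1 := Finset.prod_univ_sum (fun _ : Fin n => (Finset.univ : Finset F)) fun _ a => w a
      rw [Fintype.piFinset_univ] at h1
      rw [← h1]
      simp [hw, sum_toReal_pmf]
    have h4 := h2.trans (Finset.sum_le_sum_of_subset_of_nonneg (Finset.filter_subset _ _)
      fun x _ _ => Finset.prod_nonneg fun i _ => hw0 (x i))
    rw [h3, nsmul_eq_mul, ← le_div_iff₀ (Real.exp_pos _)] at h4
    refine h4.trans (le_of_eq ?_)
    rw [one_div, ← Real.exp_neg, neg_neg, Real.rpow_def_of_pos (by positivity)]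
    congr 1
    rw [hc]
    ring
  · intro _
    have h1 := Finset.prod_univ_sum (fun _ : Fin n => (Finset.univ : Finset F))
      fun _ a => w a * Real.exp (s * (-Real.log (w a) - c))
    rw [Fintype.piFinset_univ, Finset.prod_const, Finset.card_univ, Fintype.card_fin] at h1
    rw [show g s ^ n = _ from h1, ENNReal.ofReal_sum_of_nonneg fun x _ =>
      Finset.prod_nonneg fun i _ => mul_nonneg (hw0 _) (Real.exp_pos _).le]
    refine Finset.sum_le_sum fun x _ => ?_
    split_ifs with hx
    · exact zero_le
    · have hW : ∏ i, W (x i) = ENNReal.ofReal (∏ i, w (x i)) := by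
        rw [ENNReal.ofReal_prod_of_nonneg fun i _ => hw0 _]
        exact Finset.prod_congr rfl fun i _ => (ENNReal.ofReal_toReal (W.apply_ne_top _)).symm
      rw [hW]
      refine ENNReal.ofReal_le_ofReal ?_
      by_cases h0 : ∀ i, w (x i) ≠ 0
      · have hpos : ∀ i, 0 < w (x i) := fun i => lt_of_le_of_ne (hw0 _) (h0 i).symm
        have hlt : ∏ i, w (x i) < Real.exp (-(n * c)) := by simpa using hx
        rw [Finset.prod_mul_distrib, ← Real.exp_sum, ← Finset.mul_sum, Finset.sum_sub_distrib,
          Finset.sum_neg_distrib, ← Real.log_prod fun i _ => h0 i]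
        have hP : 0 < ∏ i, w (x i) := Finset.prod_pos fun i _ => hpos i
        have h2 : Real.log (∏ i, w (x i)) < -(n * c) := by
          rwa [Real.log_lt_iff_lt_exp hP]
        refine le_mul_of_one_le_right hP.le (Real.one_le_exp (mul_nonneg hs.le ?_))
        simp only [Finset.sum_const, Finset.card_univ, Fintype.card_fin, nsmul_eq_mul]
        linarith
      · push Not at h0
        obtain ⟨i, hi⟩ := h0
        rw [Finset.prod_eq_zero (Finset.mem_univ i) hi]
        exact Finset.prod_nonneg fun i _ => mul_nonneg (hw0 _) (Real.exp_pos _).le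

end Typical

/-- Code pairs of all large lengths with exponentially small error probabilities, for all
dimensions in the interior of the achievable region. -/
theorem eventually_exists_codePair {F : Type*} [Field F] [Fintype F] (W : Fin 2 → PMF F) {η : ℝ}
    (hη : 0 < η) : ∃ x : ℝ, 0 < x ∧
    ∀ᶠ n : ℕ in atTop, ∀ k : Fin 2 → ℕ, (∀ j, (k j : ℝ) ≤ n * (1 - entropy (W j) - 2 * η)) →
      n ≤ k 0 + k 1 → ∃ (C : CodePair F n) (D : C.Decoders),
        (∀ j, Module.finrank F (C.code j) = k j) ∧
        ∀ j, D.errorProb W j ≤ ENNReal.ofReal ((Fintype.card F : ℝ) ^ (-(n : ℝ) * x)) := by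
  classical
  have hF : 1 < Fintype.card F := Fintype.one_lt_card
  have hq : (1 : ℝ) < Fintype.card F := by exact_mod_cast hF
  have hq0 : (0 : ℝ) < Fintype.card F := by linarith
  choose ρ hρ0 hρ1 T hTcard hT using fun j => exists_typical_sets hF (W j) hη
  set σ : ℝ := (Fintype.card F : ℝ) ^ (-η) with hσ
  have hσ0 : 0 < σ := by positivity
  have hσ1 : σ < 1 := Real.rpow_lt_one_of_one_lt_of_neg hq (by linarith)
  -- A base strictly larger than every decay rate involved, so that for large `n` the constants and
  -- the sum over both channels are absorbed in `γ ^ n`.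
  obtain ⟨γ, hγ, hγ1⟩ := exists_between (max_lt (max_lt (hρ1 0) (hρ1 1)) hσ1)
  obtain ⟨hργ, hσγ⟩ := max_lt_iff.1 hγ
  have hργ : ∀ i, ρ i < γ := Fin.forall_fin_two.2 (max_lt_iff.1 hργ)
  have hγ0 : 0 < γ := hσ0.trans hσγ
  have hlogq : 0 < Real.log (Fintype.card F) := Real.log_pos hq
  have hlim : Tendsto (fun n : ℕ => ∑ i : Fin 2, ((ρ i / γ) ^ n + 2 * (σ / γ) ^ n)) atTop
      (𝓝 0) := by
    have h2 : (0 : ℝ) = ∑ i : Fin 2, (0 + 2 * 0) := by simp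
    rw [h2]
    refine tendsto_finsetSum _ fun i _ => Tendsto.add ?_ (Tendsto.const_mul _ ?_)
    · exact tendsto_pow_atTop_nhds_zero_of_lt_one (div_nonneg (hρ0 i) hγ0.le)
        ((div_lt_one hγ0).2 (hργ i))
    · exact tendsto_pow_atTop_nhds_zero_of_lt_one (div_nonneg hσ0.le hγ0.le)
        ((div_lt_one hγ0).2 hσγ)
  refine ⟨-Real.log γ / Real.log (Fintype.card F),
    div_pos (neg_pos.2 (Real.log_neg hγ0 hγ1)) hlogq, ?_⟩
  filter_upwards [hlim.eventually_le_const one_pos, eventually_gt_atTop 0] with n hn hn0 k hk hkn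
  have hkn' : ∀ j, k j ≤ n := fun j => by
    have h1 := hk j
    have h2 := entropy_nonneg (W j)
    have h3 : (0 : ℝ) < n := by exact_mod_cast hn0
    have : (k j : ℝ) ≤ n := by nlinarith
    exact_mod_cast this
  obtain ⟨C, D, hC, hD⟩ := exists_codePair_of_sets W hn0 k hkn' hkn fun j => T j n
  have hγn : (Fintype.card F : ℝ) ^ (-(n : ℝ) * (-Real.log γ / Real.log (Fintype.card F))) =
      γ ^ n := by
    rw [Real.rpow_def_of_pos hq0, ← Real.rpow_natCast, Real.rpow_def_of_pos hγ0]
    congr 1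
    field_simp
  have hσn : ∀ i, 2 * (((T i n).card : ℝ≥0∞) * (Fintype.card F : ℝ≥0∞) ^ k i /
      (Fintype.card F : ℝ≥0∞) ^ n) ≤ ENNReal.ofReal (2 * σ ^ n) := by
    intro i
    have h1 : (Fintype.card F : ℝ≥0∞) = ENNReal.ofReal (Fintype.card F) := by simp
    have h2 : (((T i n).card : ℕ) : ℝ≥0∞) = ENNReal.ofReal ((T i n).card) := by simp
    rw [ENNReal.ofReal_mul two_pos.le, ENNReal.ofReal_ofNat]
    gcongr
    rw [h1, h2, ← ENNReal.ofReal_pow hq0.le, ← ENNReal.ofReal_pow hq0.le,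
      ← ENNReal.ofReal_mul (by positivity), ← ENNReal.ofReal_div_of_pos (by positivity)]
    refine ENNReal.ofReal_le_ofReal ?_
    rw [div_le_iff₀ (by positivity)]
    calc ((T i n).card : ℝ) * (Fintype.card F : ℝ) ^ k i
        ≤ (Fintype.card F : ℝ) ^ ((n : ℝ) * (entropy (W i) + η)) *
          (Fintype.card F : ℝ) ^ (n * (1 - entropy (W i) - 2 * η)) := by
          gcongr
          · exact hTcard i n
          · rw [← Real.rpow_natCast]
            exact Real.rpow_le_rpow_of_exponent_le hq.le (hk i)
      _ = σ ^ n * (Fintype.card F : ℝ) ^ n := by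
          rw [hσ, ← Real.rpow_add hq0, ← Real.rpow_natCast, ← Real.rpow_natCast,
            ← Real.rpow_mul hq0.le, ← Real.rpow_add hq0]
          congr 1
          ring
  refine ⟨C, D, hC, fun j => (hD j).trans ?_⟩
  have hpos : ∀ i, 0 ≤ ρ i ^ n + 2 * σ ^ n := fun i =>
    add_nonneg (pow_nonneg (hρ0 i) n) (by positivity)
  calc _ ≤ ∑ i, ENNReal.ofReal (ρ i ^ n + 2 * σ ^ n) := by
        refine Finset.sum_le_sum fun i _ => ?_
        rw [ENNReal.ofReal_add (pow_nonneg (hρ0 i) n) (by positivity)]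
        exact add_le_add (hT i n) (hσn i)
    _ = ENNReal.ofReal (∑ i, (ρ i ^ n + 2 * σ ^ n)) :=
        (ENNReal.ofReal_sum_of_nonneg fun i _ => hpos i).symm
    _ ≤ _ := by
        rw [hγn]
        refine ENNReal.ofReal_le_ofReal ?_
        have : ∑ i, (ρ i ^ n + 2 * σ ^ n) =
            (∑ i : Fin 2, ((ρ i / γ) ^ n + 2 * (σ / γ) ^ n)) * γ ^ n := by
          rw [Finset.sum_mul]
          refine Finset.sum_congr rfl fun i _ => ?_
          rw [div_pow, div_pow]
          field_simp
        rw [this]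
        exact mul_le_of_le_one_left (by positivity) hn

/-! ### Asymptotics and the choice of parameters -/

section Asymptotics

variable {F : Type*} [Field F] [Fintype F]

theorem SyndromeDecoder.errorProb_le_one {n : ℕ} {C : Submodule F (Fin n → F)}
    (D : SyndromeDecoder C) (B : Submodule F (Fin n → F)) (W : PMF F) : D.errorProb B W ≤ 1 := by
  rw [← sum_prod_pmf W n]
  refine Finset.sum_le_sum fun e _ => ?_
  split_ifs
  · exact zero_le
  · exact le_rfl

omit [Fintype F] in
theorem CodePair.exists_finrank_add_eq {n : ℕ} (C : CodePair F n) :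
    ∃ k, Module.finrank F (C.code 0) + Module.finrank F (C.code 1) = n + k := by
  have h1 := finrank_dual_add (C.code 1)
  have h2 := Submodule.finrank_mono C.css
  exact Nat.exists_eq_add_of_le (by omega)

/-- The bound for the concatenated code, in terms of exponents. -/
theorem two_pow_mul_pow_le {q n N t : ℕ} (hq : 2 ≤ q) {P : ℝ≥0∞} {a R ε v : ℝ}
    (hP : P ≤ ENNReal.ofReal ((q : ℝ) ^ (-(n : ℝ) * (a - ε)))) (hn : 2 ≤ ε * n)
    (hR : R ≤ 1) (ha : ε ≤ a) (hv : v ≤ 1 / 2 * (R * a)) (ht : R * N ≤ 2 * (t + 1)) :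
    2 ^ N * P ^ (t + 1) ≤ ENNReal.ofReal ((q : ℝ) ^ (-((N * n : ℕ) : ℝ) * (v - ε))) := by
  have hq1 : (1 : ℝ) ≤ q := by exact_mod_cast (by omega : 1 ≤ q)
  have hq0 : (0 : ℝ) < q := by linarith
  have hN : (0 : ℝ) ≤ N := N.cast_nonneg
  calc 2 ^ N * P ^ (t + 1)
      ≤ ENNReal.ofReal ((q : ℝ) ^ (N : ℝ)) *
        ENNReal.ofReal ((q : ℝ) ^ (-(n : ℝ) * (a - ε))) ^ (t + 1) := by
        gcongr
        rw [Real.rpow_natCast, ENNReal.ofReal_pow hq0.le, ENNReal.ofReal_natCast]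
        gcongr
        exact_mod_cast hq
    _ = ENNReal.ofReal ((q : ℝ) ^ (N + -(n : ℝ) * (a - ε) * (t + 1))) := by
        rw [← ENNReal.ofReal_pow (by positivity), ← ENNReal.ofReal_mul (by positivity),
          ← Real.rpow_natCast _ (t + 1), ← Real.rpow_mul hq0.le, ← Real.rpow_add hq0]
        push_cast
        rfl
    _ ≤ _ := by
        refine ENNReal.ofReal_le_ofReal (Real.rpow_le_rpow_of_exponent_le hq1 ?_)
        push_cast
        have h1 : (n : ℝ) * (a - ε) * (R * N) ≤ n * (a - ε) * (2 * (t + 1)) :=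
          mul_le_mul_of_nonneg_left ht (mul_nonneg n.cast_nonneg (by linarith))
        have h2 : (N * n : ℝ) * v ≤ N * n * (1 / 2 * (R * a)) :=
          mul_le_mul_of_nonneg_left hv (by positivity)
        -- Half of the slack `ε * N * n` pays for `2 ^ N ≤ q ^ N`, the other half for the loss `ε`
        -- in the inner exponent.
        have h3 : (N : ℝ) * 2 ≤ N * (ε * n) := mul_le_mul_of_nonneg_left hn hN
        have h4 : (N * (ε * n) : ℝ) * R ≤ N * (ε * n) * 1 :=
          mul_le_mul_of_nonneg_left hR (by positivity)
        linarith

/-- Concatenation of the members of a sequence of code pairs with a given error exponent. -/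
theorem ExponentAttained.exists_codePair {W : Fin 2 → PMF F} {E : PMF F → ℝ → ℝ} {r R : Fin 2 → ℝ}
    (h : ExponentAttained W E r) (hR : ∀ j, 0 ≤ R j ∧ R j ≤ 1) {Ro : ℝ} (hRo : 0 < Ro)
    (hrR : (r 0 + r 1 - 1) * (R 0 + R 1 - 1) = Ro) {c : ℕ} (hc : 2 / Ro ≤ c) {ε : ℝ} (hε : 0 < ε)
    (M : ℕ) :
    ∃ (N : ℕ) (L : CodePair F N) (D : L.Decoders), M ≤ N ∧ |L.rate - Ro| ≤ ε ∧
      (∀ j, D.errorProb W j ≤ ENNReal.ofReal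
        ((Fintype.card F : ℝ) ^ (-(N : ℝ) * (1 / 2 * splitExponent W E (r, R) - ε)))) ∧
      ∀ j, (D j).RunsIn (7000 * N ^ (7 + c)) := by
  obtain ⟨n, C, D, δ, hn, hj⟩ := h
  have hq : 2 ≤ Fintype.card F := Fintype.one_lt_card
  have hq1 : (1 : ℝ) < Fintype.card F := by exact_mod_cast hq
  choose k hk using fun ν => (C ν).exists_finrank_add_eq
  have hn0 : ∀ᶠ ν in atTop, 0 < n ν := hn.eventually_gt_atTop 0
  set ρ := r 0 + r 1 - 1 with hρ
  have hkn : Tendsto (fun ν => (k ν : ℝ) / n ν) atTop (𝓝 ρ) := by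
    refine (((hj 0).1.add (hj 1).1).sub_const 1).congr' ?_
    filter_upwards [hn0] with ν hν
    have h1 : ((Module.finrank F ((C ν).code 0) : ℝ) + Module.finrank F ((C ν).code 1)) =
        n ν + k ν := by exact_mod_cast hk ν
    have hν' : (n ν : ℝ) ≠ 0 := by positivity
    rw [CodePair.classicalRate, CodePair.classicalRate, ← add_div, h1]
    field_simp
    ring
  have hρ0 : 0 ≤ ρ := ge_of_tendsto' hkn fun ν => by positivity
  have hR1 : R 0 + R 1 - 1 ≤ 1 := by linarith [(hR 0).2, (hR 1).2]
  have hρ1 : 0 < ρ := lt_of_le_of_ne hρ0 fun h0 => by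
    rw [← h0, zero_mul] at hrR
    exact hRo.ne hrR
  have hRR : 0 < R 0 + R 1 - 1 := pos_of_mul_pos_right (hrR ▸ hRo) hρ0
  have hρR : Ro ≤ ρ := by
    rw [← hrR]
    exact mul_le_of_le_one_right hρ0 hR1
  have hnR : Tendsto (fun ν => (n ν : ℝ)) atTop atTop := tendsto_natCast_atTop_atTop.comp hn
  -- `k / n` tends to `ρ ≥ Ro`, so `c ≥ 2 / Ro` works for every splitting. This makes the table size
  -- `q ^ n` polynomial in the length, with an exponent depending on `Ro` alone.
  have hnck : ∀ᶠ ν in atTop, n ν ≤ c * k ν := by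
    filter_upwards [hkn.eventually_const_le (show Ro / 2 < ρ by linarith), hn0] with ν hν hν0
    have hν' : (0 : ℝ) < n ν := by exact_mod_cast hν0
    rw [le_div_iff₀ hν'] at hν
    have h1 : (n ν : ℝ) ≤ 2 / Ro * k ν := by
      rw [div_mul_eq_mul_div, le_div_iff₀ hRo]
      linarith
    have h2 : (n ν : ℝ) ≤ c * k ν := h1.trans (by gcongr)
    exact_mod_cast h2
  have hk_top : Tendsto k atTop atTop := by
    have h1 : Tendsto (fun ν => (k ν : ℝ) / n ν * n ν) atTop atTop :=
      hkn.pos_mul_atTop hρ1 hnR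
    rw [← tendsto_natCast_atTop_iff (R := ℝ)]
    refine h1.congr' ?_
    filter_upwards [hn0] with ν hν
    have hν' : (n ν : ℝ) ≠ 0 := by positivity
    field_simp
  have hqk : Tendsto (fun ν => (Fintype.card F : ℝ) ^ k ν) atTop atTop :=
    (tendsto_pow_atTop_atTop_of_one_lt hq1).comp hk_top
  let d : ℕ → Fin 2 → ℕ := fun ν j => ⌊(1 - R j) * (Fintype.card F : ℝ) ^ k ν⌋₊
  have hd : ∀ j, Tendsto (fun ν => (d ν j : ℝ) / (Fintype.card F : ℝ) ^ k ν) atTop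
      (𝓝 (1 - R j)) := fun j =>
    (tendsto_nat_floor_mul_div_atTop (by linarith [(hR j).2])).comp hqk
  have hdle : ∀ ν j, (d ν j : ℝ) ≤ (1 - R j) * (Fintype.card F : ℝ) ^ k ν := fun ν j =>
    Nat.floor_le (mul_nonneg (by linarith [(hR j).2]) (by positivity))
  have hdN : ∀ ν, d ν 0 + d ν 1 ≤ Fintype.card F ^ k ν := by
    intro ν
    have h1 := hdle ν 0
    have h2 := hdle ν 1
    have h3 : 0 ≤ (R 0 + R 1 - 1) * (Fintype.card F : ℝ) ^ k ν := by positivity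
    have h4 : ((d ν 0 : ℝ) + d ν 1) ≤ (Fintype.card F : ℝ) ^ k ν := by nlinarith
    exact_mod_cast h4
  have hrate : Tendsto (fun ν => (k ν : ℝ) / n ν *
      (1 - ((d ν 0 : ℝ) + d ν 1) / (Fintype.card F : ℝ) ^ k ν)) atTop (𝓝 Ro) := by
    have h1 := hkn.mul (((hd 0).add (hd 1)).const_sub 1)
    have h2 : ρ * (1 - (1 - R 0 + (1 - R 1))) = Ro := by rw [← hrR]; ring
    rw [h2] at h1
    simpa only [add_div] using h1
  have hδ : ∀ᶠ ν in atTop, ∀ j, δ j ν ≤ ε * n ν := by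
    rw [eventually_all]
    intro j
    filter_upwards [(hj j).2.1.bound hε] with ν hν
    have h1 := (le_abs_self _).trans hν
    simpa using h1
  have hclose := hrate.eventually (Metric.closedBall_mem_nhds Ro hε)
  obtain ⟨ν, h1, h2, h3, h4, h5, h6⟩ := (hclose.and (hδ.and (hnck.and ((hk_top.eventually_gt_atTop
    0).and ((hn.eventually_ge_atTop M).and (hnR.eventually_ge_atTop (2 / ε))))))).exists
  obtain ⟨L, D', hLrate, hLerr, hLrun⟩ := exists_concatenation (C ν) (D ν) h4 (hk ν) (d ν) (hdN ν)
  have hq0 : 0 < Fintype.card F := by omega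
  have hN1 : 1 ≤ Fintype.card F ^ k ν := Nat.one_le_pow _ _ hq0
  refine ⟨Fintype.card F ^ k ν * n ν, L, D', h5.trans (Nat.le_mul_of_pos_left _ hN1), ?_, ?_, ?_⟩
  · rw [hLrate]
    exact h1
  · intro j
    set v := 1 / 2 * splitExponent W E (r, R) with hv
    have hvj : v ≤ 1 / 2 * ((1 - R j) * E (W j) (r j)) := by
      rw [hv, splitExponent]
      gcongr
      fin_cases j
      · exact min_le_left _ _
      · exact min_le_right _ _
    -- If `v ≤ ε`, the claimed bound is at least `1`. Otherwise `E` is positive and exceeds `ε`, as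
    -- the exponent estimate requires.
    by_cases hvε : v ≤ ε
    · refine ((D' j).errorProb_le_one _ _).trans ?_
      rw [ENNReal.one_le_ofReal]
      refine Real.one_le_rpow hq1.le ?_
      rw [neg_mul, ← mul_neg]
      exact mul_nonneg (Nat.cast_nonneg _) (by linarith)
    · push Not at hvε
      have hR0 : 0 ≤ 1 - R j := by linarith [(hR j).2]
      have hE : ε ≤ E (W j) (r j) := by
        have h7 : 0 < (1 - R j) * E (W j) (r j) := by linarith
        have h8 : 0 < E (W j) (r j) := pos_of_mul_pos_right h7 hR0
        have h9 : (1 - R j) * E (W j) (r j) ≤ E (W j) (r j) :=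
          mul_le_of_le_one_left h8.le (by linarith [(hR j).1])
        linarith
      refine (hLerr W j).trans (two_pow_mul_pow_le hq ?_ ?_ (by linarith [(hR j).1]) hE hvj
        ?_)
      · refine ((hj j).2.2 ν).trans (ENNReal.ofReal_le_ofReal
          (Real.rpow_le_rpow_of_exponent_le hq1.le ?_))
        have := h2 j
        linarith
      · rw [div_le_iff₀ hε] at h6
        linarith
      -- Rounding is harmless: `d + 1 ≤ 2 * (d / 2 + 1)` for either parity of `d`.
      · have h7 : (1 - R j) * (Fintype.card F : ℝ) ^ k ν < d ν j + 1 := Nat.lt_floor_add_one _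
        have h8 : (d ν j : ℝ) + 1 ≤ 2 * ((d ν j / 2 : ℕ) + 1) := by
          exact_mod_cast (by omega : d ν j + 1 ≤ 2 * (d ν j / 2 + 1))
        push_cast
        linarith
  · intro j
    refine (hLrun j).mono ?_
    have h7 : Fintype.card F ^ n ν ≤ (Fintype.card F ^ k ν * n ν) ^ c := by
      have hn1 : 1 ≤ n ν := by
        have := hk ν
        have h0 := Submodule.finrank_le ((C ν).code 0)
        have h1 := Submodule.finrank_le ((C ν).code 1)
        rw [Module.finrank_fin_fun] at h0 h1
        omega
      calc Fintype.card F ^ n ν ≤ Fintype.card F ^ (c * k ν) := Nat.pow_le_pow_right hq0 h3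
        _ = (Fintype.card F ^ k ν) ^ c := by rw [mul_comm, pow_mul]
        _ ≤ _ := Nat.pow_le_pow_left (Nat.le_mul_of_pos_right _ hn1) _
    rw [pow_add, ← mul_assoc]
    exact Nat.mul_le_mul_left _ h7

theorem le_exponentOf {q N : ℕ} (hq : 2 ≤ q) (hN : 0 < N) {P : ℝ≥0∞} {x : ℝ}
    (hP : P ≤ ENNReal.ofReal ((q : ℝ) ^ (-(N : ℝ) * x))) : (x : EReal) ≤ exponentOf q N P := by
  have hq1 : (1 : ℝ) < q := by exact_mod_cast hq
  have hlog : 0 < Real.log q := Real.log_pos hq1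
  have hN' : (0 : ℝ) < N := by exact_mod_cast hN
  have h1 := ENNReal.log_le_log hP
  rw [ENNReal.log_ofReal_of_pos (by positivity), Real.log_rpow (by positivity)] at h1
  rw [exponentOf, EReal.le_div_iff_mul_le (by exact_mod_cast mul_pos hN' hlog)
    (EReal.coe_ne_top _)]
  refine le_trans (le_of_eq ?_) (EReal.neg_le_neg_iff.2 h1)
  rw [← EReal.coe_mul, ← EReal.coe_neg]
  congr 1
  ring

omit [Fintype F] in
theorem polyTime_of_le {N : ℕ → ℕ} {L : ∀ ν, CodePair F (N ν)} {D : ∀ ν, (L ν).Decoders} {a b : ℕ}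
    (h : ∀ ν j, (D ν j).RunsIn (a * N ν ^ b)) : PolyTime D :=
  ⟨Polynomial.C a * Polynomial.X ^ b, fun ν j => by simpa using h ν j⟩

theorem tendsto_of_abs_sub_le {u : ℕ → ℝ} {a : ℝ} (h : ∀ ν, |u ν - a| ≤ 1 / ((ν : ℝ) + 1)) :
    Tendsto u atTop (𝓝 a) := by
  rw [tendsto_iff_dist_tendsto_zero]
  exact squeeze_zero (fun _ => dist_nonneg) h tendsto_one_div_add_atTop_nhds_zero_nat

/-- A diagonal choice: the `ν`-th code comes from the `ν`-th splitting of a maximizing sequence,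
with accuracy `1 / (ν + 1)` and length above `ν`. Both channels are served at once because
`splitExponent` is a minimum. -/
theorem exists_codePairs_of_nonempty {W : Fin 2 → PMF F} {E : PMF F → ℝ → ℝ}
    {S : Set (Fin 2 → ℝ)} (hS : ∀ r ∈ S, ExponentAttained W E r) {Ro : ℝ} (hRo : 0 < Ro)
    (hne : (rateSplittings S Ro).Nonempty) :
    ∃ (N : ℕ → ℕ) (L : ∀ ν, CodePair F (N ν)) (D : ∀ ν, (L ν).Decoders),
      Tendsto N atTop atTop ∧ Tendsto (fun ν => (L ν).rate) atTop (𝓝 Ro) ∧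
      (∀ j, (⨆ p ∈ rateSplittings S Ro, ((1 / 2 * splitExponent W E p : ℝ) : EReal)) ≤
        limsup (fun ν => exponentOf (Fintype.card F) (N ν) ((D ν).errorProb W j)) atTop) ∧
      PolyTime D := by
  have hq : 2 ≤ Fintype.card F := Fintype.one_lt_card
  set A : Set EReal :=
    (fun p => ((1 / 2 * splitExponent W E p : ℝ) : EReal)) '' rateSplittings S Ro with hA
  obtain ⟨u, -, hu, huA⟩ := exists_seq_tendsto_sSup (hne.image _ : A.Nonempty) (OrderTop.bddAbove A)
  choose p hp hpu using huA
  obtain ⟨c, hc⟩ := exists_nat_ge (2 / Ro)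
  choose N L D hMN hrate herr hrun using fun ν : ℕ =>
    (hS _ (hp ν).1).exists_codePair (hp ν).2.2.1 hRo (hp ν).2.2.2 hc
      (Nat.one_div_pos_of_nat (n := ν) (α := ℝ)) (ν + 1)
  refine ⟨N, L, D, tendsto_atTop_mono (fun ν => (Nat.le_succ ν).trans (hMN ν)) tendsto_id,
    tendsto_of_abs_sub_le hrate, fun j => ?_, polyTime_of_le hrun⟩
  rw [← sSup_image]
  refine le_of_forall_lt fun x hx => ?_
  obtain ⟨y, hxy, hyA⟩ := EReal.lt_iff_exists_real_btwn.1 hx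
  obtain ⟨z, hyz, hzA⟩ := EReal.lt_iff_exists_real_btwn.1 hyA
  have hyz' : 0 < z - y := sub_pos.2 (EReal.coe_lt_coe_iff.1 hyz)
  refine hxy.trans_le (le_limsup_of_frequently_le (Eventually.frequently ?_))
  filter_upwards [hu.eventually (lt_mem_nhds hzA),
    tendsto_one_div_add_atTop_nhds_zero_nat.eventually (gt_mem_nhds hyz')] with ν h1 h2
  rw [← hpu ν] at h1
  have h1 := EReal.coe_lt_coe_iff.1 h1
  have h3 := le_exponentOf hq (by have := hMN ν; omega) (herr ν j)
  refine le_trans ?_ h3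
  rw [EReal.coe_le_coe_iff]
  linarith

/-- For the whole space as both codes, exponent `0` only asks for error probability at most `1`.
This supplies codes of any rate when there is no splitting. -/
theorem exponentAttained_zero (W : Fin 2 → PMF F) :
    ExponentAttained W (fun _ _ => 0) (fun _ => 1) := by
  choose D _ using fun ν : ℕ => exists_decoder_of_set (⊤ : Submodule F (Fin (ν + 1) → F)) ∅
  refine ⟨fun ν => ν + 1, fun ν => ⟨fun _ => ⊤, le_top⟩, fun ν _ => D ν, fun _ _ => 0,
    tendsto_add_atTop_nat 1, fun j => ⟨?_, isLittleO_zero _ _, fun ν => ?_⟩⟩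
  · refine tendsto_const_nhds.congr fun ν => ?_
    rw [CodePair.classicalRate, finrank_top, Module.finrank_fin_fun, div_self]
    positivity
  · exact ((D ν).errorProb_le_one _ _).trans (by simp)

theorem exists_codePairs_of_exponentAttained {W : Fin 2 → PMF F} {E : PMF F → ℝ → ℝ}
    {S : Set (Fin 2 → ℝ)} (hS : ∀ r ∈ S, ExponentAttained W E r) {Ro : ℝ} (hRo : 0 < Ro)
    (hRo1 : Ro ≤ 1) :
    ∃ (N : ℕ → ℕ) (L : ∀ ν, CodePair F (N ν)) (D : ∀ ν, (L ν).Decoders),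
      Tendsto N atTop atTop ∧ Tendsto (fun ν => (L ν).rate) atTop (𝓝 Ro) ∧
      (∀ j, (⨆ p ∈ rateSplittings S Ro, ((1 / 2 * splitExponent W E p : ℝ) : EReal)) ≤
        limsup (fun ν => exponentOf (Fintype.card F) (N ν) ((D ν).errorProb W j)) atTop) ∧
      PolyTime D := by
  rcases (rateSplittings S Ro).eq_empty_or_nonempty with h | h
  -- With no splitting the supremum is `⊥`, and only the rate and the complexity matter. Inner rates
  -- `1, 1` and outer rates `1, Ro` have the required product.
  · obtain ⟨N, L, D, hN, hL, -, hD⟩ := exists_codePairs_of_nonempty (W := W) (E := fun _ _ => 0)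
      (S := {fun _ => 1}) (by rintro _ rfl; exact exponentAttained_zero W) hRo
      ⟨(fun _ => 1, ![1, Ro]), rfl, by simp, by simp [Fin.forall_fin_two, hRo.le, hRo1], by simp⟩
    exact ⟨N, L, D, hN, hL, fun j => by simp [h], hD⟩
  · exact exists_codePairs_of_nonempty hS hRo h

theorem exponentAttained_of_entropy (W : Fin 2 → PMF F) {η : ℝ} (hη : 0 < η)
    (h0 : ∀ j, 0 ≤ 1 - entropy (W j) - 2 * η)
    (h1 : 0 < 1 - entropy (W 0) - entropy (W 1) - 4 * η) :
    ∃ x : ℝ, 0 < x ∧ ExponentAttained W (fun _ _ => x) fun j => 1 - entropy (W j) - 2 * η := by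
  obtain ⟨x, hx, hev⟩ := eventually_exists_codePair W hη
  obtain ⟨n₁, hn₁⟩ := exists_nat_ge (2 / (1 - entropy (W 0) - entropy (W 1) - 4 * η))
  obtain ⟨n₀, hn₀⟩ := eventually_atTop.1 hev
  let k : ℕ → Fin 2 → ℕ := fun n j => ⌊(1 - entropy (W j) - 2 * η) * n⌋₊
  have hk : ∀ n j, (k n j : ℝ) ≤ n * (1 - entropy (W j) - 2 * η) := fun n j => by
    rw [mul_comm]
    exact Nat.floor_le (mul_nonneg (h0 j) n.cast_nonneg)
  -- The two floors lose less than `2` in total, and `n₁` is chosen so that the surplus `(1 - H₁ -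
  -- H₂ - 4 η) n` covers it.
  have hkn : ∀ n, n₁ ≤ n → n ≤ k n 0 + k n 1 := by
    intro n hn
    have e0 : (1 - entropy (W 0) - 2 * η) * n < k n 0 + 1 := Nat.lt_floor_add_one _
    have e1 : (1 - entropy (W 1) - 2 * η) * n < k n 1 + 1 := Nat.lt_floor_add_one _
    have e2 : (n₁ : ℝ) ≤ n := by exact_mod_cast hn
    have e3 := hn₁.trans e2
    rw [div_le_iff₀ h1] at e3
    have : (n : ℝ) ≤ k n 0 + k n 1 := by linarith
    exact_mod_cast this
  choose C D hC hD using fun ν : ℕ => hn₀ (ν + (n₀ + n₁ + 1)) (by omega) (k (ν + (n₀ + n₁ + 1)))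
    (hk _) (hkn _ (by omega))
  have hn : Tendsto (fun ν => ν + (n₀ + n₁ + 1)) atTop atTop := tendsto_add_atTop_nat _
  refine ⟨x, hx, fun ν => ν + (n₀ + n₁ + 1), C, D, fun _ _ => 0, hn,
    fun j => ⟨?_, isLittleO_zero _ _, fun ν => ?_⟩⟩
  · simp only [CodePair.classicalRate, hC]
    exact (tendsto_nat_floor_mul_div_atTop (h0 j)).comp (tendsto_natCast_atTop_atTop.comp hn)
  · simpa using hD ν j

/-- The pair `(⊤, ⊥)` has rate `0` and no errors: the first quotient is trivial, and for the second
the syndrome determines the error pattern. -/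
theorem exists_codePairs_of_rate_zero (W : Fin 2 → PMF F) :
    ∃ (N : ℕ → ℕ) (L : ∀ ν, CodePair F (N ν)) (D : ∀ ν, (L ν).Decoders),
      Tendsto N atTop atTop ∧ Tendsto (fun ν => (L ν).rate) atTop (𝓝 0) ∧
      (∀ j, Tendsto (fun ν => (D ν).errorProb W j) atTop (𝓝 0)) ∧ PolyTime D := by
  classical
  have hdual : ∀ n, dual (⊥ : Submodule F (Fin n → F)) = ⊤ := fun n => by
    rw [eq_top_iff]
    rintro y - x hx
    rw [(Submodule.mem_bot F).1 hx, zero_dotProduct]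
  let L : ∀ ν, CodePair F (ν + 1) := fun ν => ⟨![⊤, ⊥], le_top⟩
  choose D hrun hD using fun (ν : ℕ) (j : Fin 2) => exists_syndromeDecoder ((L ν).code j) id
    (t := 0) (.of_subset (Set.subset_insert _ _))
  refine ⟨fun ν => ν + 1, L, D, tendsto_add_atTop_nat 1, ?_, fun j => ?_,
    polyTime_of_le (a := 16) (b := 2) fun ν j => (hrun ν j).mono (by ring_nf; nlinarith)⟩
  · refine tendsto_const_nhds.congr fun ν => ?_
    have h0 : Module.finrank F ((L ν).code 0) = ν + 1 :=
      (finrank_top F (Fin (ν + 1) → F)).trans (Module.finrank_fin_fun F)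
    have h1 : Module.finrank F ((L ν).code 1) = 0 := finrank_bot F (Fin (ν + 1) → F)
    rw [CodePair.rate, h0, h1]
    simp
  · refine tendsto_const_nhds.congr fun ν => ?_
    symm
    refine Finset.sum_eq_zero fun e _ => if_pos ?_
    obtain ⟨e', he, he'⟩ := hD ν j e
    fin_cases j
    · have : dual ((L ν).code (Fin.rev 0)) = ⊤ := hdual _
      rw [Fin.zero_eta, this]
      exact Submodule.mem_top
    · have h1 : e - e' = 0 := he
      have h2 : e - (D ν 1).estimate ((D ν 1).H.mulVec e) = 0 := by
        rw [← h1]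
        exact congrArg (e - ·) he'
      have h3 := zero_mem (dual ((L ν).code (Fin.rev 1)))
      rw [← h2] at h3
      exact h3

/-- The exponent bound of (a) is a limsup at one fixed rate, so the finite-length statement
`ExponentAttained.exists_codePair` is used instead. The loss `η` shrinks along the sequence, while
one exponent `c` serves all `η`. -/
theorem exists_codePairs_of_entropy (W : Fin 2 → PMF F)
    (h : 0 ≤ 1 - entropy (W 0) - entropy (W 1)) :
    ∃ (N : ℕ → ℕ) (L : ∀ ν, CodePair F (N ν)) (D : ∀ ν, (L ν).Decoders),
      Tendsto N atTop atTop ∧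
      Tendsto (fun ν => (L ν).rate) atTop (𝓝 (1 - entropy (W 0) - entropy (W 1))) ∧
      (∀ j, Tendsto (fun ν => (D ν).errorProb W j) atTop (𝓝 0)) ∧ PolyTime D := by
  rcases h.eq_or_lt with h | h
  · rw [← h]
    exact exists_codePairs_of_rate_zero W
  set Δ := 1 - entropy (W 0) - entropy (W 1) with hΔ
  have hq1 : (1 : ℝ) < Fintype.card F := by exact_mod_cast Fintype.one_lt_card
  have hH := fun j => entropy_nonneg (W j)
  have hΔ1 : Δ ≤ 1 := by linarith [hH 0, hH 1]
  obtain ⟨c, hc⟩ := exists_nat_ge (4 / Δ)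
  have key : ∀ ε : ℝ, 0 < ε → ∀ M : ℕ, ∃ (N : ℕ) (L : CodePair F N) (D : L.Decoders), M ≤ N ∧
      |L.rate - Δ| ≤ ε ∧ (∀ j, D.errorProb W j ≤ ENNReal.ofReal ε) ∧
      ∀ j, (D j).RunsIn (7000 * N ^ (7 + c)) := by
    intro ε hε M
    set η := min Δ ε / 16 with hη
    have hη0 : 0 < η := by positivity
    have hηΔ : η ≤ Δ / 16 := by rw [hη]; gcongr; exact min_le_left _ _
    have hηε : η ≤ ε / 16 := by rw [hη]; gcongr; exact min_le_right _ _
    obtain ⟨x, hx, hE⟩ := exponentAttained_of_entropy W hη0 (by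
      rw [Fin.forall_fin_two]
      constructor <;> linarith [hH 0, hH 1]) (by linarith)
    -- The product of the inner rate `r₁ + r₂ - 1 = Δ - 4 η` and the outer rate `2 (1 - η) - 1`. It
    -- stays above `Δ / 2`, whence `2 / Ro ≤ 4 / Δ ≤ c`.
    set Ro := (Δ - 4 * η) * (1 - 2 * η) with hRo
    have hRo1 : Δ / 2 ≤ Ro := by rw [hRo]; nlinarith
    have hRo2 : |Ro - Δ| ≤ ε / 2 := by
      rw [abs_le, hRo]
      constructor <;> nlinarith
    set y := 1 / 2 * splitExponent W (fun _ _ => x)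
      (fun j => 1 - entropy (W j) - 2 * η, fun _ => 1 - η) with hy
    have hy0 : 0 < y := by
      have : y = 1 / 2 * (η * x) := by simp [hy, splitExponent]
      rw [this]
      positivity
    -- At least half of the positive exponent `y = η x / 2` survives the accuracy `min (ε / 2) (y /
    -- 2)`, so a large length brings the error below `ε`.
    have hlim : Tendsto (fun n : ℕ => (Fintype.card F : ℝ) ^ (-(n : ℝ) * (y / 2))) atTop (𝓝 0) := by
      have h1 : ∀ n : ℕ, (Fintype.card F : ℝ) ^ (-(n : ℝ) * (y / 2)) =
          ((Fintype.card F : ℝ) ^ (-(y / 2))) ^ n := fun n => by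
        rw [← Real.rpow_natCast, ← Real.rpow_mul (by positivity)]
        congr 1
        ring
      simp_rw [h1]
      exact tendsto_pow_atTop_nhds_zero_of_lt_one (by positivity)
        (Real.rpow_lt_one_of_one_lt_of_neg hq1 (by linarith))
    obtain ⟨M', hM'⟩ := eventually_atTop.1 (hlim.eventually_le_const hε)
    obtain ⟨N, L, D, hN, hrate, herr, hrun⟩ := hE.exists_codePair (R := fun _ => 1 - η)
      (fun j => ⟨by linarith, by linarith⟩) (Ro := Ro) (by linarith) (by rw [hRo, hΔ]; ring)
      (c := c) (le_trans (by
        rw [div_le_div_iff₀ (by linarith) h]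
        linarith) hc)
      (ε := min (ε / 2) (y / 2)) (by positivity) (max M M')
    refine ⟨N, L, D, (le_max_left _ _).trans hN, ?_, fun j => (herr j).trans ?_, hrun⟩
    · calc |L.rate - Δ| ≤ |L.rate - Ro| + |Ro - Δ| := abs_sub_le _ _ _
        _ ≤ ε / 2 + ε / 2 := add_le_add (hrate.trans (min_le_left _ _)) hRo2
        _ = ε := add_halves ε
    · refine ENNReal.ofReal_le_ofReal (le_trans (Real.rpow_le_rpow_of_exponent_le hq1.le ?_)
        (hM' N ((le_max_right _ _).trans hN)))
      have h1 := min_le_right (ε / 2) (y / 2)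
      rw [neg_mul, neg_mul, neg_le_neg_iff]
      gcongr
      linarith
  choose N L D hMN hrate herr hrun using fun ν : ℕ =>
    key (1 / ((ν : ℝ) + 1)) Nat.one_div_pos_of_nat ν
  refine ⟨N, L, D, tendsto_atTop_mono hMN tendsto_id, tendsto_of_abs_sub_le hrate, fun j => ?_,
    polyTime_of_le hrun⟩
  have h1 := ENNReal.tendsto_ofReal (tendsto_one_div_add_atTop_nhds_zero_nat (𝕜 := ℝ))
  rw [ENNReal.ofReal_zero] at h1
  exact tendsto_of_tendsto_of_tendsto_of_le_of_le tendsto_const_nhds h1 (fun _ => zero_le)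
    fun ν => herr ν j

end Asymptotics

end CSS

theorem theorem1 {F : Type*} [Field F] [Fintype F] (W : Fin 2 → PMF F) :
    (∀ (E : PMF F → ℝ → ℝ) (S : Set (Fin 2 → ℝ)),
      (∀ r ∈ S, CSS.ExponentAttained W E r) →
      ∀ Ro : ℝ, 0 < Ro → Ro ≤ 1 →
        ∃ (N : ℕ → ℕ) (L : ∀ ν, CSS.CodePair F (N ν)) (D : ∀ ν, (L ν).Decoders),
          Tendsto N atTop atTop ∧
          Tendsto (fun ν => (L ν).rate) atTop (𝓝 Ro) ∧
          (∀ j, (⨆ p ∈ CSS.rateSplittings S Ro,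
                  ((1 / 2 * CSS.splitExponent W E p : ℝ) : EReal)) ≤
                limsup (fun ν =>
                  CSS.exponentOf (Fintype.card F) (N ν) ((D ν).errorProb W j)) atTop) ∧
          CSS.PolyTime D) ∧
    (0 ≤ 1 - CSS.entropy (W 0) - CSS.entropy (W 1) →
      ∃ (N : ℕ → ℕ) (L : ∀ ν, CSS.CodePair F (N ν)) (D : ∀ ν, (L ν).Decoders),
        Tendsto N atTop atTop ∧
        Tendsto (fun ν => (L ν).rate) atTop
          (𝓝 (1 - CSS.entropy (W 0) - CSS.entropy (W 1))) ∧
        (∀ j, Tendsto (fun ν => (D ν).errorProb W j) atTop (𝓝 0)) ∧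
        CSS.PolyTime D) := by
  refine ⟨fun E S hS Ro hRo hRo1 => ?_, CSS.exists_codePairs_of_entropy W⟩
  exact CSS.exists_codePairs_of_exponentAttained hS hRo hRo1
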